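/- **Setting.** Let $d\ge 0$, let $\mu,\nu$ be Borel probability measures on $\mathbb R^d$, let $\pi_*$ be a coupling of $\mu$ and $\nu$, and let $\Gamma=\operatorname{spt}\pi_*\subset\mathbb R^d\times\mathbb R^d$, with projections $X_0=\operatorname{proj}_1\Gamma$ and $Y_0=\operatorname{proj}_2\Gamma$. For a cost $c$ define $$I(x,y)=\sup_{k\ge 2}\ \sup_{(x_i,y_i)_{i=2}^k\subset\Gamma}\ \sup_{\sigma\in\Sigma(k)}\ \sum_{i=1}^k c(x_i,y_i)-\sum_{i=1}^k c(x_i,y_{\sigma(i)}),\qquad (x_1,y_1):=(x,y),$$ where $\Sigma(k)$ is the set of permutations of $\{1,\dots,k\}$. **Notions.** Let $\Omega,\Omega'\subset\mathbb R^d$ be domains (non-empty, open, connected) and $c$ be $C^1$ on $\Omega\times\Omega'$. A function $\psi:\Omega\to\mathbb R\cup\{+\infty\}$, $\psi\not\equiv+\infty$, is *$c$-convex* if $\psi(x)=\sup_{y\in\Omega'}[\zeta(y)-c(x,y)]$ for some $\zeta:\Omega'\to[-\infty,\infty]$. Put $\psi^c(y)=\inf_{x\in\Omega}[c(x,y)+\psi(x)]$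 and $\partial_c\psi(x)=\{y\in\Omega':\psi^c(y)-\psi(x)=c(x,y)\}$. The subdifferential $\partial\psi(x)$ is the set of $p\in\mathbb R^d$ such that $\psi(x')\ge\psi(x)+\langle p,x'-x\rangle+o(\|x'-x\|)$ as $x'\to x$ in $\Omega$ (empty if $\psi(x)=+\infty$). A function is *locally semiconvex* if near each point it is the sum of a convex function and a $C^{1,1}$ function. A set $D\subset\Omega'$ is *$c$-convex with respect to* $S\subset\Omega$ if for all $x\in S$ and $y_1,y_2\in D$ the segment from $-\nabla_xc(x,y_1)$ to $-\nabla_xc(x,y_2)$ is contained in $-\nabla_xc(x,D)$; it is *strictly* $c$-convex if, moreover, whenever $y_1\ne y_2$, every $y\in D$ for which $-\nabla_xc(x,y)$ lies in the corresponding open segment is an interior point of $D$. For functions on $\Omega'$ and subsets of $\Omega$ the same notions are used with the two variables of $c$ exchanged. **Assumption on the cost.** $\Omega,\Omega'$ are domains in $\mathbb R^d$ with $X_0\subset\Omega$ and $Y_0\subset\Omega'$; $c$ is $C^1$ on $\Omega\times\Omega'$; $\nabla_xc(x,\cdot)$ is injective on $\Omega'$ for each $x\in\Omega$ and $\nabla_yc(\cdot,y)$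 is injective on $\Omega$ for each $y\in\Omega'$; $X_0$ is strictly $c$-convex with respect to $Y_0$, and $\Omega'$ is $c$-convex with respect to $\Omega$; every $c$-convex function $\psi$ on $\Omega$ is locally semiconvex and satisfies $-\nabla_xc(x,\partial_c\psi(x))=\partial\psi(x)$ for all $x\in\Omega$, and the analogue holds for $c$-convex functions on $\Omega'$. **Dual representation.** Assume also that there is a $c$-convex $\psi$ on $\Omega$ with $y\in\partial_c\psi(x)$ for all $(x,y)\in\Gamma$ (so that $\Gamma$ is $c$-cyclically monotone) and $I(x,y)=c(x,y)-\psi^c(y)+\psi(x)$ for all $(x,y)\in X_0\times Y_0$. **Proposition 5.6.** Under these assumptions: 1. Let $(x,y)\in(X_0\times Y_0)\setminus\Gamma$ with $x\in\partial X_0$, and suppose that for some $r>0$, $I(\tilde x,y)>0$ for all $\tilde x\in\operatorname{Int}X_0\cap B_r(x)$. Then $I(x,y)>0$. 2. If $\mu\ll\mathcal L^d$ and $\operatorname{spt}\nu$ is at most countable with no accumulation points in $\mathbb R^d$, then $\{I=0\}\cap(X_0\times Y_0)=\Gamma$. -/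

import Mathlib

open MeasureTheory Set Filter Topology

namespace CostTransport

/-- The space `ℝ^d` with its Euclidean norm. -/
abbrev Eu (d : ℕ) : Type := EuclideanSpace ℝ (Fin d)

/-- The cost with its two variables exchanged; every notion below for functions on the second
domain is the notion for functions on the first domain, applied to the exchanged cost. -/
def swapCost {d : ℕ} (c : Eu d → Eu d → ℝ) : Eu d → Eu d → ℝ := fun y x => c x y

/-- `-∇ₓ c(x, y)`. For fixed `x`, the inverse of `y ↦ -∇ₓ c(x, y)` is the `c`-exponential map
at `x`. -/
noncomputable def negGrad {d : ℕ} (c : Eu d → Eu d → ℝ) (x y : Eu d) : Eu d :=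
  -gradient (fun x' => c x' y) x

/-- The twist condition in the first variable: `∇ₓ c(x, ·)` is injective on `Ω'`
for every `x ∈ Ω`. -/
def Twist {d : ℕ} (c : Eu d → Eu d → ℝ) (Ω Ω' : Set (Eu d)) : Prop :=
  ∀ x ∈ Ω, InjOn (fun y => gradient (fun x' => c x' y) x) Ω'

/-- `D` is `c`-convex with respect to `S`: for `x ∈ S` and `y₁, y₂ ∈ D`, the `c`-exponential map
at `x` is defined on the whole segment joining `-∇ₓ c(x, y₁)` and `-∇ₓ c(x, y₂)` and maps it
into `D`, that is, the `c`-segment of `y₁, y₂` with respect to `x` is contained in `D`. -/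
def CConvexSet {d : ℕ} (c : Eu d → Eu d → ℝ) (S D : Set (Eu d)) : Prop :=
  ∀ x ∈ S, ∀ y₁ ∈ D, ∀ y₂ ∈ D,
    segment ℝ (negGrad c x y₁) (negGrad c x y₂) ⊆ negGrad c x '' D

/-- `D` is strictly `c`-convex with respect to `S`: it is `c`-convex, and for distinct points of
`D` the open `c`-segment (without its end points) lies in the interior of `D`. -/
def StrictCConvexSet {d : ℕ} (c : Eu d → Eu d → ℝ) (S D : Set (Eu d)) : Prop :=
  CConvexSet c S D ∧
    ∀ x ∈ S, ∀ y₁ ∈ D, ∀ y₂ ∈ D, y₁ ≠ y₂ → ∀ y ∈ D,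
      negGrad c x y ∈ openSegment ℝ (negGrad c x y₁) (negGrad c x y₂) → y ∈ interior D

/-- `ψ : Ω → ℝ ∪ {+∞}` is a (proper) `c`-convex function on `Ω`. Only the values of `ψ` on `Ω`
matter, here and below. -/
def CConvexFun {d : ℕ} (c : Eu d → Eu d → ℝ) (Ω Ω' : Set (Eu d)) (ψ : Eu d → EReal) : Prop :=
  (∀ x ∈ Ω, ψ x ≠ ⊥) ∧ (∃ x ∈ Ω, ψ x ≠ ⊤) ∧
    ∃ ζ : Eu d → EReal, ∀ x ∈ Ω, ψ x = ⨆ y ∈ Ω', (ζ y - (c x y : EReal))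

/-- The `c`-transform `ψᶜ(y) = inf_{x ∈ Ω} [c(x, y) + ψ(x)]`. -/
noncomputable def cTransform {d : ℕ} (c : Eu d → Eu d → ℝ) (Ω : Set (Eu d)) (ψ : Eu d → EReal)
    (y : Eu d) : EReal :=
  ⨅ x ∈ Ω, ((c x y : EReal) + ψ x)

/-- The `c`-subdifferential of `ψ` at `x`: all `y ∈ Ω'` with `ψᶜ(y) - ψ(x) = c(x, y)`. -/
def cSubdiff {d : ℕ} (c : Eu d → Eu d → ℝ) (Ω Ω' : Set (Eu d)) (ψ : Eu d → EReal)
    (x : Eu d) : Set (Eu d) :=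
  {y | y ∈ Ω' ∧ cTransform c Ω ψ y - ψ x = (c x y : EReal)}

/-- The ordinary subdifferential of `ψ` at `x`: all `p` such that `ψ(x)` is finite and
`ψ(x') ≥ ψ(x) + ⟨p, x' - x⟩ + o(‖x' - x‖)` as `x' → x`, `x' ∈ Ω`. -/
def subdiff {d : ℕ} (Ω : Set (Eu d)) (ψ : Eu d → EReal) (x : Eu d) : Set (Eu d) :=
  {p | ψ x ≠ ⊤ ∧ ψ x ≠ ⊥ ∧ ∀ ε : ℝ, 0 < ε → ∀ᶠ x' in 𝓝[Ω] x,
    ψ x + ((inner ℝ p (x' - x) - ε * ‖x' - x‖ : ℝ) : EReal) ≤ ψ x'}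

/-- Convexity on `U` of an extended-real-valued function: its epigraph over `U` is convex. -/
def ConvexExt {d : ℕ} (U : Set (Eu d)) (g : Eu d → EReal) : Prop :=
  Convex ℝ {p : Eu d × ℝ | p.1 ∈ U ∧ g p.1 ≤ (p.2 : EReal)}

/-- `ψ` is semiconvex on `U`: the sum of a convex function and a function of class `C^{1,1}`. -/
def SemiconvexOn {d : ℕ} (U : Set (Eu d)) (ψ : Eu d → EReal) : Prop :=
  ∃ (g : Eu d → EReal) (h : Eu d → ℝ), ConvexExt U g ∧
    DifferentiableOn ℝ h U ∧ (∃ K : NNReal, LipschitzOnWith K (gradient h) U) ∧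
    ∀ x ∈ U, ψ x = g x + (h x : EReal)

/-- `ψ` is locally semiconvex on `Ω`: semiconvex on a ball around each point of `Ω`. -/
def LocallySemiconvexOn {d : ℕ} (Ω : Set (Eu d)) (ψ : Eu d → EReal) : Prop :=
  ∀ x ∈ Ω, ∃ r : ℝ, 0 < r ∧ Metric.ball x r ⊆ Ω ∧ SemiconvexOn (Metric.ball x r) ψ

/-- Every `c`-convex function `ψ` on `Ω` is locally semiconvex and satisfies
`-∇ₓ c(x, ∂_c ψ(x)) = ∂ψ(x)` for all `x ∈ Ω`. -/
def SubdiffCondition {d : ℕ} (c : Eu d → Eu d → ℝ) (Ω Ω' : Set (Eu d)) : Prop :=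
  ∀ ψ : Eu d → EReal, CConvexFun c Ω Ω' ψ →
    LocallySemiconvexOn Ω ψ ∧
      ∀ x ∈ Ω, negGrad c x '' cSubdiff c Ω Ω' ψ x = subdiff Ω ψ x

/-- The structural assumption on the cost `c`, the domains `Ω, Ω'` and the sets
`X₀ ⊆ Ω`, `Y₀ ⊆ Ω'`. -/
structure CostAssumption {d : ℕ} (c : Eu d → Eu d → ℝ) (Ω Ω' X₀ Y₀ : Set (Eu d)) : Prop where
  isOpen_left : IsOpen Ω
  isConnected_left : IsConnected Ω
  isOpen_right : IsOpen Ω'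
  isConnected_right : IsConnected Ω'
  subset_left : X₀ ⊆ Ω
  subset_right : Y₀ ⊆ Ω'
  contDiffOn : ContDiffOn ℝ 1 (fun p : Eu d × Eu d => c p.1 p.2) (Ω ×ˢ Ω')
  twist_left : Twist c Ω Ω'
  twist_right : Twist (swapCost c) Ω' Ω
  strict : StrictCConvexSet (swapCost c) Y₀ X₀
  convex : CConvexSet c Ω Ω'
  subdiff_left : SubdiffCondition c Ω Ω'
  subdiff_right : SubdiffCondition (swapCost c) Ω' Ω

/-- The rate function: with `q₀ = (x, y)`, the supremum over all `k ≥ 2`, all points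
`q₁, …, q_{k-1}` of `Γ` (here `k = n + 2`) and all permutations `σ` of the `k` indices of
`∑ i, c(xᵢ, yᵢ) - ∑ i, c(xᵢ, y_{σ i})`. -/
noncomputable def rateFun {d : ℕ} (c : Eu d → Eu d → ℝ) (Γ : Set (Eu d × Eu d))
    (x y : Eu d) : EReal :=
  ⨆ (n : ℕ) (z : Fin (n + 1) → Eu d × Eu d) (_ : ∀ i, z i ∈ Γ)
    (σ : Equiv.Perm (Fin (n + 2))),
    let q : Fin (n + 2) → Eu d × Eu d := Fin.cons (x, y) z
    (((∑ i, c (q i).1 (q i).2) - ∑ i, c (q i).1 (q (σ i)).2 : ℝ) : EReal)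

/-- `ψ` is a Kantorovich potential for `Γ`: a `c`-convex function on `Ω` whose
`c`-subdifferential contains `Γ`. -/
def IsKantorovichPotential {d : ℕ} (c : Eu d → Eu d → ℝ) (Ω Ω' : Set (Eu d))
    (Γ : Set (Eu d × Eu d)) (ψ : Eu d → EReal) : Prop :=
  CConvexFun c Ω Ω' ψ ∧ ∀ p ∈ Γ, p.2 ∈ cSubdiff c Ω Ω' ψ p.1

end CostTransport

/-! On `X₀ × Y₀` the rate is the gap in `ψᶜ(y) ≤ c(x, y) + ψ(x)`, so it vanishes exactly when `y ∈
∂_c ψ(x)`. Both claims thus exclude contact pairs outside `Γ`.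

Boundary: let `(x, y)` be such a pair and `(x', y) ∈ Γ`. The vectors `-∇_y c(x, y)` and `-∇_y c(x',
y)` are subgradients at `y` of `-ψᶜ`, which is `c`-convex for the exchanged cost. Subdifferentials
are convex, so the whole `c`-segment from `x` to `x'` is in contact with `y`. Strict `c`-convexity
puts its open part in `interior X₀`, and it comes arbitrarily close to `x`
(`exists_mem_interior_mem_cSubdiff`).

Interior: near an interior `x` only finitely many `y'` are coupled, none equal to `y`, so `ψ` is
locally a finite maximum `χ` of `c`-affine functions. Subdifferentials are local, while
`c`-subdifferentials are global: the `c`-affine function of `y` through `x` lies below `χ`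
everywhere. Each `x'` coupled with `y` is then on a level set of some `c(·, y) - c(·, y')`, which is
null by the twist (`volume_setOf_mem_eq_zero`). But `y` is isolated in the support of `ν`, so it is
coupled with positive `μ`-mass. Closedness of `Γ` and the boundary argument then cover the rest of
`X₀`.

The twist makes the gradient maps continuous and injective, no more; continuity of their inverses is
invariance of domain, proved here from Brouwer's theorem. -/

/-! ### Jacobian integrals of maps equal to the identity off a ball -/

section Brouwer

open Metric Polynomial

variable {E : Type*} [NormedAddCommGroup E] [NormedSpace ℝ E] [FiniteDimensional ℝ E]

/-- Polynomial dependence on `t` carries the Jacobian identity from small `t`, where `x + t g(x)` is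
bijective, to `t = 1`. -/
lemma ContinuousLinearMap.exists_polynomial_eval_eq_det_id_add_smul (A : E →L[ℝ] E) :
    ∃ p : ℝ[X], p.natDegree ≤ Module.finrank ℝ E ∧
      ∀ t, p.eval t = (ContinuousLinearMap.id ℝ E + t • A).det := by
  let b := Module.finBasis ℝ E
  let M := LinearMap.toMatrix b b (A : E →ₗ[ℝ] E)
  refine ⟨((X : ℝ[X]) • M.map C + (1 : Matrix _ _ ℝ).map C).det, ?_, fun t => ?_⟩
  · simpa using natDegree_det_X_add_C_le M 1
  · have h1 : (ContinuousLinearMap.id ℝ E + t • A).det = (1 + t • M).det := by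
      rw [ContinuousLinearMap.det, ← LinearMap.det_toMatrix b]
      congr 1
      simp [M]
    rw [h1, ← coe_evalRingHom, RingHom.map_det]
    congr 1
    ext i j
    by_cases h : i = j
    · subst h; simp [add_comm, mul_comm t]
    · simp [h, mul_comm t]

/-- Along `id + s A` the determinant starts at 1 and cannot vanish: a kernel vector would satisfy
`‖v‖ = s ‖A v‖ < ‖v‖`. -/
lemma ContinuousLinearMap.det_id_add_pos (A : E →L[ℝ] E) (hA : ‖A‖ < 1) :
    0 < (ContinuousLinearMap.id ℝ E + A).det := by
  have hne : ∀ s ∈ Icc (0 : ℝ) 1, (ContinuousLinearMap.id ℝ E + s • A).det ≠ 0 := by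
    intro s hs h0
    obtain ⟨v, hv, hv0⟩ := (Submodule.ne_bot_iff _).1
      (LinearMap.bot_lt_ker_of_det_eq_zero h0).ne'
    have hv' : v + s • A v = 0 := by simpa using hv
    have h1 : ‖v‖ = s * ‖A v‖ := by
      rw [← Real.norm_of_nonneg hs.1, ← norm_smul, ← norm_neg (s • A v),
        ← eq_neg_of_add_eq_zero_left hv']
    have h2 := A.le_opNorm v
    have h3 : 0 < ‖v‖ := norm_pos_iff.2 hv0
    nlinarith [hs.1, hs.2, norm_nonneg (A v)]
  have hc : Continuous fun s : ℝ => (ContinuousLinearMap.id ℝ E + s • A).det :=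
    ContinuousLinearMap.continuous_det.comp (by fun_prop)
  by_contra hneg
  have h0 : (ContinuousLinearMap.id ℝ E + (0 : ℝ) • A).det = 1 := by
    simp [ContinuousLinearMap.det]
  have hmem : (0 : ℝ) ∈ Icc (ContinuousLinearMap.id ℝ E + (1 : ℝ) • A).det
      (ContinuousLinearMap.id ℝ E + (0 : ℝ) • A).det := by
    rw [h0, one_smul]; exact ⟨not_lt.1 hneg, zero_le_one⟩
  obtain ⟨s, hs, h⟩ := intermediate_value_Icc' zero_le_one hc.continuousOn hmem
  exact hne s hs h

lemma LipschitzWith.bijective_id_add {g : E → E} {C : NNReal} (hg : LipschitzWith C g)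
    (hC : C < 1) : Function.Bijective fun x => x + g x := by
  have happ : ApproximatesLinearOn (fun x => x + g x)
      ((ContinuousLinearEquiv.refl ℝ E : E ≃L[ℝ] E) : E →L[ℝ] E) univ C := by
    intro x _ y _
    have := hg.dist_le_mul x y
    rw [dist_eq_norm, dist_eq_norm] at this
    refine le_trans (le_of_eq ?_) this
    congr 1
    simp; abel
  have hcond : Subsingleton E ∨ C < ‖(((ContinuousLinearEquiv.refl ℝ E).symm : E ≃L[ℝ] E) :
      E →L[ℝ] E)‖₊⁻¹ := by
    rcases subsingleton_or_nontrivial E with h | h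
    · exact Or.inl h
    · right
      have : (((ContinuousLinearEquiv.refl ℝ E).symm : E ≃L[ℝ] E) : E →L[ℝ] E) =
        ContinuousLinearMap.id ℝ E := rfl
      rw [this, ContinuousLinearMap.nnnorm_id, inv_one]
      exact hC
  refine ⟨fun x y hxy => ?_, happ.surjective hcond⟩
  have := happ.injective hcond (a₁ := ⟨x, mem_univ _⟩) (a₂ := ⟨y, mem_univ _⟩) hxy
  exact congrArg Subtype.val this

variable [MeasurableSpace E] [BorelSpace E] (μ : Measure E) [μ.IsAddHaarMeasure]

/-- The map `x + g(x)` is a bijection fixing every point off the ball, so it maps the ball onto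
itself; change of variables applies, with a positive Jacobian. -/
lemma LipschitzWith.integral_det_id_add_of_lt_one {g : E → E} {C : NNReal}
    (hg : LipschitzWith C g) (hC : C < 1) {R : ℝ} (h0 : ∀ x, R ≤ ‖x‖ → g x = 0)
    (hd : DifferentiableOn ℝ g (ball 0 R)) :
    IntegrableOn (fun x => (ContinuousLinearMap.id ℝ E + fderiv ℝ g x).det) (ball 0 R) μ ∧
    ∫ x in ball 0 R, (ContinuousLinearMap.id ℝ E + fderiv ℝ g x).det ∂μ = μ.real (ball 0 R) := by
  set F : E → E := fun x => x + g x with hF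
  have hbij : Function.Bijective F := hg.bijective_id_add hC
  have hout : ∀ x, x ∉ ball (0 : E) R → F x = x := fun x hx => by
    simp [hF, h0 x (by simpa using hx)]
  have himg : F '' ball 0 R = ball 0 R := by
    ext z
    constructor
    · rintro ⟨x, hx, rfl⟩
      by_contra h
      exact h (by rwa [hbij.1 (hout _ h)])
    · intro hz
      obtain ⟨x, rfl⟩ := hbij.2 z
      by_contra h
      have hx : x ∉ ball (0 : E) R := fun hx => h ⟨x, hx, rfl⟩
      rw [hout x hx] at hz
      exact hx hz
  have hder : ∀ x ∈ ball (0 : E) R, HasFDerivWithinAt F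
      (ContinuousLinearMap.id ℝ E + fderiv ℝ g x) (ball 0 R) x := fun x hx =>
    ((hasFDerivAt_id x).add
      ((hd x hx).differentiableAt (isOpen_ball.mem_nhds hx)).hasFDerivAt).hasFDerivWithinAt
  have hpos : ∀ x, 0 < (ContinuousLinearMap.id ℝ E + fderiv ℝ g x).det := fun x =>
    ContinuousLinearMap.det_id_add_pos _
      ((norm_fderiv_le_of_lipschitz ℝ hg).trans_lt (by exact_mod_cast hC))
  have hmeas : Measurable fun x => (ContinuousLinearMap.id ℝ E + fderiv ℝ g x).det :=
    ContinuousLinearMap.continuous_det.measurable.comp ((measurable_fderiv ℝ g).const_add _)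
  have hl := lintegral_abs_det_fderiv_eq_addHaar_image μ measurableSet_ball hder hbij.1.injOn
  rw [himg] at hl
  simp_rw [abs_of_pos (hpos _)] at hl
  constructor
  · refine ⟨hmeas.aestronglyMeasurable, ?_⟩
    rw [hasFiniteIntegral_iff_ofReal (Eventually.of_forall fun x => (hpos x).le), hl]
    exact measure_ball_lt_top
  · rw [integral_eq_lintegral_of_nonneg_ae (Eventually.of_forall fun x => (hpos x).le)
      hmeas.aestronglyMeasurable, hl, Measure.real]

/-- The integral of the Jacobian of a Lipschitz map that is the identity off a ball is the volume
of the ball. -/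
lemma LipschitzWith.integral_det_id_add {g : E → E} {C : NNReal}
    (hg : LipschitzWith C g) {R : ℝ} (h0 : ∀ x, R ≤ ‖x‖ → g x = 0)
    (hd : DifferentiableOn ℝ g (ball 0 R)) :
    ∫ x in ball 0 R, (ContinuousLinearMap.id ℝ E + fderiv ℝ g x).det ∂μ = μ.real (ball 0 R) := by
  set n := Module.finrank ℝ E
  -- `n + 1` distinct nodes determine a polynomial of degree at most `n`; they are small enough that
  -- each `v k • g` is a strict contraction.
  let v : ℕ → ℝ := fun k => ((k + 1 : ℝ) * (C + 1))⁻¹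
  have hvpos : ∀ k, 0 < v k := fun k => by positivity
  have hvinj : InjOn v (Finset.range (n + 1)) := by
    intro i _ j _ hij
    have h1 := inv_injective hij
    have h2 : (C : ℝ) + 1 ≠ 0 := by positivity
    simpa using mul_right_cancel₀ h2 h1
  have hs : (Finset.range (n + 1)).Nonempty := ⟨0, by simp⟩
  -- Weights extrapolating from the nodes to 1. They sum to 1, so a common value of the integrals at
  -- the nodes is also the value at 1.
  let L : ℕ → ℝ := fun k => (Lagrange.basis (Finset.range (n + 1)) v k).eval 1
  have hL : ∑ k ∈ Finset.range (n + 1), L k = 1 := by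
    have := congrArg (Polynomial.eval 1) (Lagrange.sum_basis hvinj hs)
    simpa [Polynomial.eval_finsetSum, L] using this
  have hpt : ∀ x, (ContinuousLinearMap.id ℝ E + fderiv ℝ g x).det =
      ∑ k ∈ Finset.range (n + 1),
        L k * (ContinuousLinearMap.id ℝ E + v k • fderiv ℝ g x).det := by
    intro x
    obtain ⟨p, hp, hpe⟩ :=
      ContinuousLinearMap.exists_polynomial_eval_eq_det_id_add_smul (fderiv ℝ g x)
    have hdeg : p.degree < (Finset.range (n + 1)).card := by
      rw [Finset.card_range]
      exact Polynomial.degree_le_natDegree.trans_lt (by exact_mod_cast Nat.lt_succ_of_le hp)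
    have h1 := hpe 1
    rw [one_smul] at h1
    rw [← h1]
    conv_lhs => rw [Lagrange.eq_interpolate hvinj hdeg]
    rw [Lagrange.interpolate_apply, Polynomial.eval_finsetSum]
    refine Finset.sum_congr rfl fun k _ => ?_
    rw [Polynomial.eval_mul, Polynomial.eval_C, hpe, mul_comm]
  have hk : ∀ k, IntegrableOn (fun x => (ContinuousLinearMap.id ℝ E +
        v k • fderiv ℝ g x).det) (ball 0 R) μ ∧
      ∫ x in ball 0 R, (ContinuousLinearMap.id ℝ E + v k • fderiv ℝ g x).det ∂μ =
        μ.real (ball 0 R) := by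
    intro k
    have hlip : LipschitzWith (‖v k‖₊ * C) (v k • g) := by
      refine LipschitzWith.of_dist_le_mul fun x y => ?_
      simp only [Pi.smul_apply, dist_smul₀, NNReal.coe_mul, coe_nnnorm, mul_assoc]
      exact mul_le_mul_of_nonneg_left (hg.dist_le_mul x y) (norm_nonneg _)
    have hlt : ‖v k‖₊ * C < 1 := by
      rw [← NNReal.coe_lt_coe]
      simp only [NNReal.coe_mul, coe_nnnorm, NNReal.coe_one, Real.norm_of_nonneg (hvpos k).le, v]
      rw [inv_mul_lt_iff₀ (by positivity)]
      nlinarith [C.coe_nonneg, (Nat.cast_nonneg k : (0 : ℝ) ≤ k),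
        mul_nonneg (Nat.cast_nonneg k : (0 : ℝ) ≤ k) C.coe_nonneg]
    have := hlip.integral_det_id_add_of_lt_one μ hlt (R := R) (fun x hx => by simp [h0 x hx])
      (hd.const_smul _)
    simpa only [fderiv_const_smul_field, Pi.smul_apply] using this
  simp_rw [hpt]
  rw [integral_finsetSum _ fun k _ => (hk k).1.const_mul _]
  simp_rw [integral_const_mul, (hk _).2, ← Finset.sum_mul, hL, one_mul]

end Brouwer

/-! ### Brouwer's theorem from the Jacobian integral -/

section Brouwer

open Metric

variable {E : Type*} [NormedAddCommGroup E]

lemma exists_pos_forall_le_norm_id_add [ProperSpace E] {u : E → E} (hu : Continuous u) {R : ℝ}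
    (hR : 0 < R) (h0 : ∀ x, R ≤ ‖x‖ → u x = 0) (hne : ∀ x, x + u x ≠ 0) :
    ∃ δ > 0, ∀ x, δ ≤ ‖x + u x‖ := by
  obtain ⟨m, -, hm⟩ := (isCompact_closedBall (0 : E) R).exists_isMinOn
    ⟨0, mem_closedBall_self hR.le⟩ (f := fun x => ‖x + u x‖) (by fun_prop)
  refine ⟨min R ‖m + u m‖, lt_min hR (norm_pos_iff.2 (hne m)), fun x => ?_⟩
  rcases le_total ‖x‖ R with h | h
  · exact (min_le_right _ _).trans (hm (by simpa using h))
  · rw [h0 x h, add_zero]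
    exact (min_le_left _ _).trans h

lemma norm_normalize_sub_normalize_le [NormedSpace ℝ E] {z w : E} (hz : z ≠ 0) (hw : w ≠ 0) :
    ‖‖z‖⁻¹ • z - ‖w‖⁻¹ • w‖ ≤ 2 * ‖z‖⁻¹ * ‖z - w‖ := by
  have hz' := norm_pos_iff.2 hz
  have hw' := norm_pos_iff.2 hw
  have h1 : ‖z‖⁻¹ • z - ‖w‖⁻¹ • w = ‖z‖⁻¹ • (z - w) + (‖z‖⁻¹ * (‖w‖ - ‖z‖) * ‖w‖⁻¹) • w := by
    have : ‖z‖⁻¹ * (‖w‖ - ‖z‖) * ‖w‖⁻¹ = ‖z‖⁻¹ - ‖w‖⁻¹ := by field_simp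
    rw [this]; module
  rw [h1]
  refine (norm_add_le _ _).trans ?_
  have h3 : |‖w‖ - ‖z‖| ≤ ‖z - w‖ := by
    rw [norm_sub_rev]; exact abs_norm_sub_norm_le _ _
  have h2 : ‖(‖z‖⁻¹ * (‖w‖ - ‖z‖) * ‖w‖⁻¹) • w‖ = ‖z‖⁻¹ * |‖w‖ - ‖z‖| := by
    rw [norm_smul, norm_mul, norm_mul, norm_inv, norm_norm, norm_inv, norm_norm, Real.norm_eq_abs]
    field_simp
  rw [h2, norm_smul, norm_inv, norm_norm]
  have := mul_le_mul_of_nonneg_left h3 (inv_nonneg.2 hz'.le)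
  linarith

variable [InnerProductSpace ℝ E] [FiniteDimensional ℝ E]

/-- Differentiating `‖K‖²` shows that the range of `A` is orthogonal to `K x ≠ 0`. -/
lemma HasFDerivAt.det_eq_zero_of_norm_eventually_eq {K : E → E} {A : E →L[ℝ] E} {x : E} {R : ℝ}
    (hR : 0 < R) (hK : HasFDerivAt K A x) (hn : ∀ᶠ x' in 𝓝 x, ‖K x'‖ = R) : A.det = 0 := by
  by_contra hdet
  have h1 : HasFDerivAt (fun x' => ‖K x'‖ ^ 2) _ x := hK.norm_sq
  have h2 : HasFDerivAt (fun x' => ‖K x'‖ ^ 2) (0 : E →L[ℝ] ℝ) x :=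
    (hasFDerivAt_const (R ^ 2) x).congr_of_eventuallyEq (hn.mono fun y hy => by simp [hy])
  have h3 := h1.unique h2
  obtain ⟨v, hv⟩ := (LinearMap.equivOfDetNeZero (A : E →ₗ[ℝ] E) hdet).surjective (K x)
  have hv' : A v = K x := hv
  have h4 := congrArg (fun L : E →L[ℝ] ℝ => L v) h3
  have h5 : ‖K x‖ = R := hn.self_of_nhds
  simp [hv', h5, hR.ne'] at h4

/-- Without a zero, rescaling `x + u x` gives a Lipschitz map `K` that is the identity off the ball
and sends the ball into the sphere. Its Jacobian vanishes in the ball, yet must integrate to the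
volume of the ball. -/
lemma ContDiff.exists_add_eq_zero {u : E → E} (hu : ContDiff ℝ 1 u) {R : ℝ} (hR : 0 < R)
    (h0 : ∀ x, R ≤ ‖x‖ → u x = 0) : ∃ x, x + u x = 0 := by
  by_contra! hne
  obtain ⟨δ, hδ, hδle⟩ := exists_pos_forall_le_norm_id_add hu.continuous hR h0 hne
  have hcs : HasCompactSupport u := HasCompactSupport.intro (isCompact_closedBall (0 : E) R)
    fun x hx => h0 x (by simpa using (not_le.1 (by simpa using hx)).le)
  obtain ⟨C, hC⟩ := ContDiff.lipschitzWith_of_hasCompactSupport hcs hu one_ne_zero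
  let H : E → E := fun x => x + u x
  have hH : LipschitzWith (1 + C) H := LipschitzWith.id.add hC
  let N : E → E := fun x => ‖H x‖⁻¹ • H x
  have hNnorm : ∀ x, ‖N x‖ = 1 := fun x => by
    simp only [N, norm_smul, norm_inv, norm_norm]
    exact inv_mul_cancel₀ (norm_ne_zero_iff.2 (hne x))
  have hN : ∀ x y, ‖N x - N y‖ ≤ 2 * δ⁻¹ * (1 + C) * ‖x - y‖ := by
    intro x y
    refine (norm_normalize_sub_normalize_le (hne x) (hne y)).trans ?_
    have h1 := hH.dist_le_mul x y
    rw [dist_eq_norm, dist_eq_norm] at h1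
    have h2 : ‖x + u x‖⁻¹ ≤ δ⁻¹ := inv_anti₀ hδ (hδle x)
    calc 2 * ‖x + u x‖⁻¹ * ‖H x - H y‖ ≤ 2 * δ⁻¹ * ((1 + C : NNReal) * ‖x - y‖) := by gcongr
      _ = _ := by push_cast; ring
  -- The maximum glues the two regimes: length `R` inside the ball, the identity outside.
  let m : E → ℝ := fun x => max ‖x‖ R
  have hm : ∀ x y, |m x - m y| ≤ ‖x - y‖ := fun x y =>
    (abs_max_sub_max_le_abs _ _ _).trans (abs_norm_sub_norm_le _ _)
  let K : E → E := fun x => m x • N x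
  have hout : ∀ x, R ≤ ‖x‖ → K x = x := fun x hx => by
    have : ‖x‖ ≠ 0 := (hR.trans_le hx).ne'
    simp only [K, m, N, H, max_eq_left hx, h0 x hx, add_zero, smul_smul]
    rw [mul_inv_cancel₀ this, one_smul]
  let g : E → E := fun x => K x - x
  have hg0 : ∀ x, R ≤ ‖x‖ → g x = 0 := fun x hx => by simp [g, hout x hx]
  let M : NNReal := ⟨R * (2 * δ⁻¹ * (1 + C)) + 2, by positivity⟩
  have hgin : ∀ x y, ‖x‖ ≤ R → ‖g x - g y‖ ≤ M * ‖x - y‖ := by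
    intro x y hx
    have hmx : m x = R := max_eq_right hx
    have : g x - g y = R • (N x - N y) + (m x - m y) • N y - (x - y) := by
      simp only [g, K, hmx]; module
    rw [this]
    calc _ ≤ ‖R • (N x - N y)‖ + ‖(m x - m y) • N y‖ + ‖x - y‖ :=
          (norm_sub_le _ _).trans (by gcongr; exact norm_add_le _ _)
      _ ≤ R * (2 * δ⁻¹ * (1 + C) * ‖x - y‖) + ‖x - y‖ + ‖x - y‖ := by
          rw [norm_smul, norm_smul, hNnorm, mul_one, Real.norm_of_nonneg hR.le, Real.norm_eq_abs]
          gcongr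
          · exact hN x y
          · exact hm x y
      _ = M * ‖x - y‖ := by
          rw [show (M : ℝ) = R * (2 * δ⁻¹ * (1 + C)) + 2 from rfl]; ring
  have hg : LipschitzWith M g := by
    refine LipschitzWith.of_dist_le_mul fun x y => ?_
    rw [dist_eq_norm, dist_eq_norm]
    rcases le_total ‖x‖ R with hx | hx
    · exact hgin x y hx
    rcases le_total ‖y‖ R with hy | hy
    · rw [norm_sub_rev, norm_sub_rev x]; exact hgin y x hy
    · rw [hg0 x hx, hg0 y hy, sub_zero, norm_zero]; positivity
  have hKin : ∀ x ∈ ball (0 : E) R, K x = R • N x := fun x hx => by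
    simp only [K, m, max_eq_right (mem_ball_zero_iff.1 hx).le]
  have hNd : Differentiable ℝ N := by
    have hHd : Differentiable ℝ H := differentiable_id.add (hu.differentiable one_ne_zero)
    intro x
    exact (((hHd x).norm ℝ (hne x)).inv (norm_ne_zero_iff.2 (hne x))).smul (hHd x)
  have hgd : DifferentiableOn ℝ g (ball 0 R) := by
    refine DifferentiableOn.sub ?_ differentiableOn_id
    exact (hNd.const_smul R).differentiableOn.congr hKin
  borelize E
  let μ : Measure E := volume
  have hint := hg.integral_det_id_add μ hg0 hgd
  have hz : ∫ x in ball (0 : E) R, (ContinuousLinearMap.id ℝ E + fderiv ℝ g x).det ∂μ = 0 := by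
    refine setIntegral_eq_zero_of_forall_eq_zero fun x hx => ?_
    have hnhds := isOpen_ball.mem_nhds hx
    have hd : HasFDerivAt K (ContinuousLinearMap.id ℝ E + fderiv ℝ g x) x := by
      have := (hasFDerivAt_id x).add ((hgd x hx).differentiableAt hnhds).hasFDerivAt
      convert this using 1
      ext y; simp [g]
    refine hd.det_eq_zero_of_norm_eventually_eq hR (eventually_of_mem hnhds fun y hy => ?_)
    rw [hKin y hy, norm_smul, hNnorm, mul_one, Real.norm_of_nonneg hR.le]
  rw [hz] at hint
  have hpos : 0 < μ.real (ball (0 : E) R) :=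
    ENNReal.toReal_pos (measure_ball_pos μ _ hR).ne' measure_ball_lt_top.ne
  exact hpos.ne hint

/-- A form of the Brouwer fixed point theorem: `-u` has a fixed point if `u` is bounded and
continuous. -/
theorem Continuous.exists_add_eq_zero {u : E → E} (hu : Continuous u) {M : ℝ}
    (hM : ∀ x, ‖u x‖ ≤ M) : ∃ x, x + u x = 0 := by
  by_contra! hne
  have hM0 : 0 ≤ M := (norm_nonneg _).trans (hM 0)
  -- A zero of `x + w x` has norm at most `M`, where the cutoff is 1, so it would be a zero of `x +
  -- u x`.
  let χ : E → ℝ := fun x => max 0 (min 1 (M + 2 - ‖x‖))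
  have hχ : Continuous χ := by fun_prop
  let w : E → E := fun x => χ x • u x
  have hw : Continuous w := hχ.smul hu
  have hχ0 : ∀ x, M + 2 ≤ ‖x‖ → χ x = 0 := fun x hx =>
    max_eq_left ((min_le_right _ _).trans (by linarith))
  have hw0 : ∀ x, M + 2 ≤ ‖x‖ → w x = 0 := fun x hx => by simp [w, hχ0 x hx]
  have hwM : ∀ x, ‖w x‖ ≤ M := fun x => by
    have h1 : 0 ≤ χ x := le_max_left _ _
    have h2 : χ x ≤ 1 := max_le zero_le_one (min_le_left _ _)
    rw [norm_smul, Real.norm_of_nonneg h1]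
    nlinarith [hM x, norm_nonneg (u x)]
  have hwne : ∀ x, x + w x ≠ 0 := by
    intro x h
    have hx : ‖x‖ ≤ M := by
      rw [eq_neg_of_add_eq_zero_left h, norm_neg]; exact hwM x
    have hχ1 : χ x = 1 := by
      simp only [χ]; rw [min_eq_left (by linarith), max_eq_right zero_le_one]
    exact hne x (by simpa [w, hχ1] using h)
  obtain ⟨δ, hδ, hδle⟩ := exists_pos_forall_le_norm_id_add hw (by linarith) hw0 hwne
  obtain ⟨v, hv, hvw, hvs⟩ := hw.exists_contDiff_approx 1 (ε := fun _ => δ) continuous_const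
    fun _ => hδ
  obtain ⟨x, hx⟩ := ContDiff.exists_add_eq_zero (by exact_mod_cast hv) (R := M + 2) (by linarith)
    fun x hx => by
      by_contra h
      exact hvs h (hw0 x hx)
  have h1 := hvw x
  have h2 := hδle x
  rw [dist_eq_norm, ← norm_neg, eq_neg_of_add_eq_zero_right hx] at h1
  rw [show -(-x - w x) = x + w x by abel] at h1
  exact absurd h2 (not_le.2 h1)

end Brouwer

/-! ### Invariance of domain -/

section InvarianceOfDomain

open Metric

variable {E : Type*} [NormedAddCommGroup E] [InnerProductSpace ℝ E] [FiniteDimensional ℝ E]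

lemma exists_image_eq_zero_of_leftInverse_near {f G : E → E} {a : E} {r : ℝ} (hr : 0 < r)
    (hf : ContinuousOn f (closedBall a r)) (hG : ContinuousOn G (f '' closedBall a r))
    (hGf : ∀ x ∈ closedBall a r, ‖G (f x) - (x - a)‖ ≤ r) :
    ∃ x ∈ closedBall a r, G (f x) = 0 := by
  -- Radial projection onto the ball. Brouwer's theorem is applied to `G (f (a + p x)) - p x`; the
  -- resulting zero has norm at most `r`, so `p` fixes it.
  let p : E → E := fun x => (r / max r ‖x‖) • x
  have hmax : ∀ x : E, 0 < max r ‖x‖ := fun x => lt_max_of_lt_left hr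
  have hp : Continuous p :=
    (continuous_const.div (by fun_prop) fun x => (hmax x).ne').smul continuous_id
  have hpr : ∀ x, ‖p x‖ ≤ r := fun x => by
    rw [norm_smul, Real.norm_of_nonneg (by have := hmax x; positivity), div_mul_eq_mul_div,
      div_le_iff₀ (hmax x)]
    exact mul_le_mul_of_nonneg_left (le_max_right _ _) hr.le
  have hmem : ∀ x, a + p x ∈ closedBall a r := fun x => by simpa using hpr x
  have hcont : Continuous fun x => G (f (a + p x)) :=
    (hG.comp hf (mapsTo_image _ _)).comp_continuous (by fun_prop) hmem
  obtain ⟨x, hx⟩ := Continuous.exists_add_eq_zero (hcont.sub hp) (M := r) fun x => by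
    simpa using hGf _ (hmem x)
  have hxr : ‖x‖ ≤ r := by
    rw [eq_neg_of_add_eq_zero_left hx, norm_neg]
    simpa using hGf _ (hmem x)
  have hpx : p x = x := by simp [p, max_eq_left hxr, div_self hr.ne']
  refine ⟨a + p x, hmem x, ?_⟩
  have hx' : x + (G (f (a + p x)) - p x) = 0 := hx
  rw [hpx] at hx' ⊢
  simpa using hx'

/-- If `f a` were not interior to the image `S`, a point `c ∉ S` near it would allow pushing `S`
radially away from `c`. A perturbed inverse `Q` composed with this push `Φ` has no zero on `S`, yet
stays within `r` of the true inverse, against the preceding lemma. -/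
lemma image_closedBall_mem_nhds_of_injOn {f : E → E} {a : E} {r : ℝ} (hr : 0 < r)
    (hf : ContinuousOn f (closedBall a r)) (hinj : InjOn f (closedBall a r)) :
    f '' closedBall a r ∈ 𝓝 (f a) := by
  borelize E
  set S := f '' closedBall a r with hS
  have hScomp : IsCompact S := (isCompact_closedBall a r).image_of_continuousOn hf
  have haB : a ∈ closedBall a r := mem_closedBall_self hr.le
  obtain ⟨G, hGc, hG⟩ : ∃ G : E → E, Continuous G ∧ ∀ x ∈ closedBall a r, G (f x) = x - a := by
    have : CompactSpace (closedBall a r) := isCompact_iff_compactSpace.1 (isCompact_closedBall a r)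
    have he : IsClosedEmbedding ((closedBall a r).domRestrict f) :=
      (continuousOn_iff_continuous_domRestrict.1 hf).isClosedEmbedding (injOn_iff_injective.1 hinj)
    obtain ⟨G, hG⟩ := ContinuousMap.exists_extension (Y := E) he
      ⟨fun x : closedBall a r => (x : E) - a, by fun_prop⟩
    exact ⟨G, G.continuous, fun x hx => congrArg (fun φ => φ ⟨x, hx⟩) hG⟩
  by_contra hnot
  obtain ⟨ρ, hρ, hGρ⟩ := Metric.continuousAt_iff.1 (hGc.continuousAt (x := f a)) (r / 10)
    (by positivity)
  have hGa : G (f a) = 0 := by simp [hG a haB]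
  simp only [hGa, dist_zero_right] at hGρ
  set ε := ρ / 3 with hε
  have hε0 : 0 < ε := by positivity
  obtain ⟨c, hc, hcS⟩ : ∃ c, dist c (f a) < ε ∧ c ∉ S := by
    by_contra! h
    exact hnot (mem_of_superset (ball_mem_nhds _ hε0) h)
  have hGc' : ∀ y, ‖y - c‖ ≤ ε → ‖G y‖ < r / 10 := fun y hy => by
    refine hGρ ?_
    have := dist_triangle y c (f a)
    rw [dist_eq_norm y c] at this
    linarith
  have hSc : ∀ y ∈ S, ‖y - c‖ ≠ 0 := fun y hy h => by
    rw [norm_eq_zero, sub_eq_zero] at h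
    exact hcS (h ▸ hy)
  let Φ : E → E := fun y => c + max (ε / ‖y - c‖) 1 • (y - c)
  have hΦc : ContinuousOn Φ S := by
    refine continuousOn_const.add (ContinuousOn.smul ?_ (by fun_prop))
    exact ContinuousOn.sup (ContinuousOn.div (by fun_prop) (by fun_prop) hSc) continuousOn_const
  have hΦout : ∀ y ∈ S, ε ≤ ‖y - c‖ → Φ y = y := fun y hy h => by
    have : ε / ‖y - c‖ ≤ 1 := div_le_one_of_le₀ h (norm_nonneg _)
    simp [Φ, max_eq_right this]
  have hΦin : ∀ y ∈ S, ‖y - c‖ ≤ ε → ‖Φ y - c‖ = ε := fun y hy h => by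
    have hpos : 0 < ‖y - c‖ := (norm_nonneg _).lt_of_ne' (hSc y hy)
    have : 1 ≤ ε / ‖y - c‖ := (one_le_div hpos).2 h
    simp only [Φ, max_eq_left this, add_sub_cancel_left]
    rw [norm_smul, Real.norm_of_nonneg (by positivity), div_mul_cancel₀ _ hpos.ne']
  -- On `S` the only zero of `G` is `f a`, which is closer than `ε` to `c`.
  obtain ⟨δ, hδ, hδr, hδG⟩ : ∃ δ > 0, δ ≤ r / 10 ∧ ∀ y ∈ S, ε ≤ ‖y - c‖ → δ ≤ ‖G y‖ := by
    have hcl : IsCompact (S ∩ {y | ε ≤ ‖y - c‖}) :=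
      hScomp.inter_right (isClosed_le continuous_const (by fun_prop))
    rcases (S ∩ {y | ε ≤ ‖y - c‖}).eq_empty_or_nonempty with he | hne
    · exact ⟨r / 10, by positivity, le_rfl, fun y hy h => (eq_empty_iff_forall_notMem.1 he y ⟨hy, h⟩).elim⟩
    · obtain ⟨m, hm, hmin⟩ := hcl.exists_isMinOn hne (f := fun y => ‖G y‖) (by fun_prop)
      refine ⟨min (r / 10) ‖G m‖, lt_min (by positivity) (norm_pos_iff.2 ?_), min_le_left _ _,
        fun y hy h => (min_le_right _ _).trans (hmin ⟨hy, h⟩)⟩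
      obtain ⟨⟨x, hx, rfl⟩, hmε⟩ := hm
      rw [hG x hx, sub_ne_zero]
      rintro rfl
      rw [dist_comm, dist_eq_norm] at hc
      exact absurd hmε (not_le.2 hc)
  obtain ⟨P, hP, hPG, -⟩ := hGc.exists_contDiff_approx 1 (ε := fun _ => δ / 2) continuous_const
    fun _ => by positivity
  -- A differentiable map sends the null sphere to a null set, so a tiny translation removes all
  -- zeros on it.
  obtain ⟨b, hb, hbP⟩ : ∃ b, ‖b‖ < δ / 2 ∧ b ∉ P '' sphere c ε := by
    by_contra! h
    have hnull : volume (P '' sphere c ε) = 0 :=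
      addHaar_image_eq_zero_of_differentiableOn_of_addHaar_eq_zero volume
        (hP.differentiable (by simp)).differentiableOn
        (Measure.addHaar_sphere_of_ne_zero _ _ hε0.ne')
    refine (measure_ball_pos volume (0 : E) (half_pos hδ)).ne' (measure_mono_null ?_ hnull)
    exact fun b hb => h b (by simpa using hb)
  let Q : E → E := fun y => P y - b
  have hQG : ∀ y, ‖G y - Q y‖ < δ := fun y => by
    have h1 := hPG y
    rw [dist_comm, dist_eq_norm] at h1
    calc ‖G y - Q y‖ = ‖(G y - P y) + b‖ := by congr 1; simp only [Q]; abel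
      _ ≤ _ := norm_add_le _ _
      _ < δ := by linarith
  have hQ0 : ∀ y ∈ S, Q (Φ y) ≠ 0 := fun y hy h => by
    rcases le_total ε ‖y - c‖ with hle | hle
    · rw [hΦout y hy hle] at h
      have := hQG y
      rw [h, sub_zero] at this
      exact absurd (hδG y hy hle) (not_le.2 this)
    · exact hbP ⟨Φ y, by simpa [dist_eq_norm] using hΦin y hy hle, sub_eq_zero.1 h⟩
  have hQnear : ∀ y ∈ S, ‖Q (Φ y) - G y‖ ≤ r := fun y hy => by
    rcases le_total ε ‖y - c‖ with hle | hle
    · rw [hΦout y hy hle, norm_sub_rev]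
      linarith [hQG y]
    · have h1 := hQG (Φ y)
      have h2 := hGc' _ (hΦin y hy hle).le
      have h3 := hGc' y hle
      have : Q (Φ y) - G y = -(G (Φ y) - Q (Φ y)) + (G (Φ y) - G y) := by abel
      rw [this]
      have h4 := norm_add_le (-(G (Φ y) - Q (Φ y))) (G (Φ y) - G y)
      have h5 := norm_sub_le (G (Φ y)) (G y)
      rw [norm_neg] at h4
      linarith
  have hQc : ContinuousOn (fun y => Q (Φ y)) S :=
    (hP.continuous.sub continuous_const).comp_continuousOn hΦc
  obtain ⟨x, hx, hx0⟩ := exists_image_eq_zero_of_leftInverse_near hr hf hQc fun x hx => by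
    rw [← hG x hx]; exact hQnear _ (mem_image_of_mem f hx)
  exact hQ0 _ (mem_image_of_mem f hx) hx0

variable {V : Type*} [NormedAddCommGroup V] [NormedSpace ℝ V] [FiniteDimensional ℝ V]

/-- **Invariance of domain**: an injective continuous map from an open subset of a
finite-dimensional space to that space is open. -/
theorem image_mem_nhds_of_continuousOn_of_injOn {f : V → V} {U s : Set V} (hU : IsOpen U)
    (hf : ContinuousOn f U) (hinj : InjOn f U) {a : V} (ha : a ∈ U) (hs : s ∈ 𝓝 a) :
    f '' (s ∩ U) ∈ 𝓝 (f a) := by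
  -- The passage to Euclidean coordinates covers `Eu d × Eu d`, whose norm is the sup norm.
  let e : V ≃L[ℝ] EuclideanSpace ℝ (Fin (Module.finrank ℝ V)) := toEuclidean
  have hnhds : e.symm ⁻¹' (s ∩ U) ∈ 𝓝 (e a) :=
    e.symm.continuous.continuousAt.preimage_mem_nhds
      (by simpa using inter_mem hs (hU.mem_nhds ha))
  obtain ⟨r, hr, hrs⟩ := Metric.nhds_basis_closedBall.mem_iff.1 hnhds
  have hrU : ∀ x ∈ closedBall (e a) r, e.symm x ∈ s ∩ U := fun x hx => hrs hx
  have h := image_closedBall_mem_nhds_of_injOn (f := fun x => e (f (e.symm x))) hr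
    (e.continuous.comp_continuousOn (hf.comp e.symm.continuous.continuousOn
      fun x hx => (hrU x hx).2))
    fun x hx y hy hxy => e.symm.injective (hinj (hrU x hx).2 (hrU y hy).2 (e.injective hxy))
  simp only [e.symm_apply_apply] at h
  have h2 := e.continuous.continuousAt.preimage_mem_nhds h
  refine mem_of_superset h2 ?_
  rintro y ⟨x, hx, hxy⟩
  exact ⟨e.symm x, hrU x hx, e.injective hxy⟩

/-- Openness of `f` is continuity of its inverse. It replaces the inverse function theorem, since
`c` is only `C¹` and its gradient merely continuous. -/
lemma tendsto_of_tendsto_image_of_injOn {f : V → V} {U : Set V} (hU : IsOpen U)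
    (hf : ContinuousOn f U) (hinj : InjOn f U) {a : V} (ha : a ∈ U) {ι : Type*} {l : Filter ι}
    {u : ι → V} (hu : ∀ᶠ i in l, u i ∈ U) (h : Tendsto (fun i => f (u i)) l (𝓝 (f a))) :
    Tendsto u l (𝓝 a) := by
  intro s hs
  have hev : ∀ᶠ i in l, f (u i) ∈ f '' (s ∩ U) :=
    h (image_mem_nhds_of_continuousOn_of_injOn hU hf hinj ha hs)
  change ∀ᶠ i in l, u i ∈ s
  filter_upwards [hev, hu] with i hi hiU
  obtain ⟨x, hx, hxi⟩ := hi
  exact hinj hx.2 hiU hxi ▸ hx.1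

end InvarianceOfDomain

/-! ### Null level sets -/

section LevelSets

variable {V : Type*} [NormedAddCommGroup V] [NormedSpace ℝ V] [FiniteDimensional ℝ V]
  [MeasurableSpace V] [BorelSpace V] (μ : Measure V) [μ.IsAddHaarMeasure]

/-- A level set along which the derivative does not vanish has measure zero. -/
lemma MeasureTheory.Measure.addHaar_eq_zero_of_hasFDerivAt_ne_zero {f : V → ℝ} {f' : V → V →L[ℝ] ℝ}
    {Z : Set V} {a : ℝ} (hf : ∀ x ∈ Z, HasFDerivAt f (f' x) x) (hne : ∀ x ∈ Z, f' x ≠ 0)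
    (ha : ∀ x ∈ Z, f x = a) : μ Z = 0 := by
  have hv : ∀ x, ∃ v : V, x ∈ Z → f' x v = -1 := by
    intro x
    by_cases hx : x ∈ Z
    · obtain ⟨w, hw⟩ := DFunLike.ne_iff.1 (hne x hx)
      refine ⟨-(f' x w)⁻¹ • w, fun _ => ?_⟩
      rw [map_smul, smul_eq_mul, neg_mul, inv_mul_cancel₀ hw]
    · exact ⟨0, fun h => absurd h hx⟩
  choose v hv using hv
  -- On `Z` the identity agrees with `y ↦ y + (f y - a) • v x`, whose derivative at `x` kills `v x`
  -- because `f' x (v x) = -1`. So the identity has a singular derivative within `Z`, and `Z` is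
  -- null as its own image.
  have h := addHaar_image_eq_zero_of_det_fderivWithin_eq_zero μ (s := Z) (f := id)
    (f' := fun x => ContinuousLinearMap.id ℝ V + (f' x).smulRight (v x)) ?_ ?_
  · simpa using h
  · intro x hx
    have h1 : HasFDerivAt (fun y => y + (f y - a) • v x)
        (ContinuousLinearMap.id ℝ V + (f' x).smulRight (v x)) x :=
      (hasFDerivAt_id x).add (((hf x hx).sub_const a).smul_const (v x))
    exact h1.hasFDerivWithinAt.congr (fun y hy => by simp [ha y hy]) (by simp [ha x hx])
  · intro x hx
    by_contra hdet
    have hinj := (LinearMap.equivOfDetNeZero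
      ((ContinuousLinearMap.id ℝ V + (f' x).smulRight (v x) : V →L[ℝ] V) : V →ₗ[ℝ] V)
      hdet).injective
    have h0 : (ContinuousLinearMap.id ℝ V + (f' x).smulRight (v x)) (v x) = 0 := by
      simp [hv x hx]
    have : v x = 0 := hinj (h0.trans (map_zero _).symm)
    have h1 := hv x hx
    rw [this, map_zero] at h1
    norm_num at h1

end LevelSets

namespace CostTransport

variable {d : ℕ} {c : Eu d → Eu d → ℝ} {Ω Ω' : Set (Eu d)} {ψ : Eu d → EReal}

/-! ### Duality between `ψ` and its `c`-transform -/

section Transform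

lemma cTransform_le {x : Eu d} (hx : x ∈ Ω) (y : Eu d) :
    cTransform c Ω ψ y ≤ (c x y : EReal) + ψ x :=
  iInf₂_le x hx

/-- The `c`-subdifferential consists of the points whose `c`-affine function supports `ψ`. -/
lemma mem_cSubdiff_iff {x y : Eu d} (hx : x ∈ Ω) :
    y ∈ cSubdiff c Ω Ω' ψ x ↔ y ∈ Ω' ∧ ∃ a : ℝ, ψ x = a ∧
      ∀ x' ∈ Ω, ((a + c x y - c x' y : ℝ) : EReal) ≤ ψ x' := by
  have key : ∀ b : ℝ, (∀ x' ∈ Ω, ((b - c x' y : ℝ) : EReal) ≤ ψ x') ↔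
      (b : EReal) ≤ cTransform c Ω ψ y := by
    intro b
    rw [cTransform, le_iInf₂_iff]
    refine forall₂_congr fun x' _ => ?_
    rw [EReal.coe_sub, EReal.sub_le_iff_le_add (by simp) (by simp), add_comm]
  constructor
  · rintro ⟨hy, h⟩
    refine ⟨hy, ?_⟩
    induction hψ : ψ x with
    | bot =>
      rw [hψ, EReal.sub_bot fun h' => by simp [h'] at h] at h
      simp at h
    | top => simp [hψ] at h
    | coe a =>
      refine ⟨a, rfl, (key _).2 ?_⟩
      rw [hψ] at h
      have := congrArg (· + (a : EReal)) h
      simp only [EReal.sub_add_cancel] at this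
      rw [this, ← EReal.coe_add, add_comm]
  · rintro ⟨hy, a, ha, h⟩
    refine ⟨hy, ?_⟩
    have h1 := (key _).1 h
    have h2 := cTransform_le (c := c) (ψ := ψ) hx y
    rw [ha, ← EReal.coe_add, add_comm] at h2
    rw [le_antisymm h2 h1, ha, ← EReal.coe_sub]
    congr 1; ring

lemma cTransform_eq_of_mem_cSubdiff {x y : Eu d} (hx : x ∈ Ω) (h : y ∈ cSubdiff c Ω Ω' ψ x) :
    ∃ a : ℝ, ψ x = a ∧ cTransform c Ω ψ y = ((c x y + a : ℝ) : EReal) := by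
  obtain ⟨-, a, ha, -⟩ := (mem_cSubdiff_iff hx).1 h
  refine ⟨a, ha, ?_⟩
  have := congrArg (· + (a : EReal)) h.2
  simp only [ha, EReal.sub_add_cancel] at this
  rw [this, EReal.coe_add]

lemma mem_cSubdiff_of_cTransform_eq {x y : Eu d} (hy : y ∈ Ω') {a : ℝ} (ha : ψ x = a)
    (h : cTransform c Ω ψ y = ((c x y + a : ℝ) : EReal)) : y ∈ cSubdiff c Ω Ω' ψ x := by
  refine ⟨hy, ?_⟩
  rw [h, ha, ← EReal.coe_sub]
  congr 1; ring

/-- Since `ζ ≤ ψᶜ`, a `c`-convex function is dominated by the supremum of `ψᶜ(y) - c(x, y)`: half of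
biduality. -/
lemma CConvexFun.le_of_forall_cTransform_le (hψ : CConvexFun c Ω Ω' ψ) {x : Eu d} (hx : x ∈ Ω)
    {m : ℝ} (h : ∀ y ∈ Ω', cTransform c Ω ψ y ≤ ((m + c x y : ℝ) : EReal)) : ψ x ≤ m := by
  obtain ⟨-, -, ζ, hζ⟩ := hψ
  rw [hζ x hx]
  refine iSup₂_le fun y hy => ?_
  rw [EReal.sub_le_iff_le_add (by simp) (by simp), ← EReal.coe_add]
  refine le_trans (le_iInf₂ fun x' hx' => ?_) (h y hy)
  have : ζ y - (c x' y : EReal) ≤ ψ x' := by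
    rw [hζ x' hx']; exact le_iSup₂ (f := fun y _ => ζ y - (c x' y : EReal)) y hy
  rw [EReal.sub_le_iff_le_add (by simp) (by simp)] at this
  rwa [add_comm]

lemma CConvexFun.neg_cTransform (hψ : CConvexFun c Ω Ω' ψ) {y₀ : Eu d} (hy₀ : y₀ ∈ Ω')
    (hfin : cTransform c Ω ψ y₀ ≠ ⊥) :
    CConvexFun (swapCost c) Ω' Ω fun y => -cTransform c Ω ψ y := by
  obtain ⟨-, ⟨x₀, hx₀, htop⟩, -⟩ := hψ
  refine ⟨fun y _ h => ?_, ⟨y₀, hy₀, by simpa using hfin⟩, fun x => -ψ x, fun y _ => ?_⟩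
  · have h1 := cTransform_le (c := c) (ψ := ψ) hx₀ y
    rw [EReal.neg_eq_bot_iff.1 h, top_le_iff] at h1
    exact EReal.add_ne_top (EReal.coe_ne_top _) htop h1
  · apply le_antisymm
    · rw [EReal.neg_le]
      refine le_iInf₂ fun x hx => ?_
      rw [EReal.neg_le]
      refine le_trans (le_of_eq ?_) (le_iSup₂ (f := fun x _ => -ψ x - (swapCost c y x : EReal)) x hx)
      rw [EReal.neg_add (by simp) (by simp), sub_eq_add_neg, sub_eq_add_neg, add_comm]
      rfl
    · refine iSup₂_le fun x hx => ?_
      rw [EReal.le_neg]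
      refine (cTransform_le hx y).trans (le_of_eq ?_)
      rw [sub_eq_add_neg, EReal.neg_add (by simp) (by simp), sub_eq_add_neg, neg_neg, neg_neg,
        add_comm]
      rfl

/-- By biduality contact is symmetric in `x` and `y`, so the assumption on the second domain can be
used for contact pairs of `ψ`. -/
lemma CConvexFun.mem_cSubdiff_neg_cTransform_iff (hψ : CConvexFun c Ω Ω' ψ) {x y : Eu d}
    (hx : x ∈ Ω) (hy : y ∈ Ω') :
    x ∈ cSubdiff (swapCost c) Ω' Ω (fun y => -cTransform c Ω ψ y) y ↔
      y ∈ cSubdiff c Ω Ω' ψ x := by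
  constructor
  · intro h
    obtain ⟨-, b, hb, hle⟩ := (mem_cSubdiff_iff hy).1 h
    have hb' : cTransform c Ω ψ y = ((-b : ℝ) : EReal) := by
      rw [EReal.coe_neg, ← hb, neg_neg]
    have h1 : ψ x ≤ ((-b - c x y : ℝ) : EReal) := by
      refine hψ.le_of_forall_cTransform_le hx fun y' hy' => ?_
      have := hle y' hy'
      rw [EReal.le_neg, ← EReal.coe_neg] at this
      refine this.trans (le_of_eq ?_)
      simp only [swapCost]
      congr 1; ring
    have h2 := cTransform_le (c := c) (ψ := ψ) hx y
    have h3 : ((-b - c x y : ℝ) : EReal) ≤ ψ x := by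
      rw [EReal.coe_sub, EReal.sub_le_iff_le_add (by simp) (by simp), ← hb', add_comm]
      exact h2
    refine mem_cSubdiff_of_cTransform_eq hy (le_antisymm h1 h3) ?_
    rw [hb']; congr 1; ring
  · intro h
    obtain ⟨a, ha, hT⟩ := cTransform_eq_of_mem_cSubdiff hx h
    refine (mem_cSubdiff_iff hy).2 ⟨hx, -(c x y + a), by simp only [hT, EReal.coe_neg],
      fun y' hy' => ?_⟩
    rw [EReal.le_neg, ← EReal.coe_neg]
    refine (cTransform_le hx y').trans (le_of_eq ?_)
    rw [ha, ← EReal.coe_add]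
    simp only [swapCost]
    congr 1; ring

end Transform

/-! ### Subdifferentials: convexity, locality, passage to `c`-subdifferentials -/

section Subdiff

lemma subdiff_convex (Ω : Set (Eu d)) (ψ : Eu d → EReal) (x : Eu d) :
    Convex ℝ (subdiff Ω ψ x) := by
  rintro p ⟨h1, h2, hp⟩ q ⟨-, -, hq⟩ s t hs ht hst
  refine ⟨h1, h2, fun ε hε => ?_⟩
  filter_upwards [hp ε hε, hq ε hε] with x' hpx hqx
  have hle : inner ℝ (s • p + t • q) (x' - x) ≤
      max (inner ℝ p (x' - x)) (inner ℝ q (x' - x)) := by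
    rw [inner_add_left, real_inner_smul_left, real_inner_smul_left]
    have h3 := mul_le_mul_of_nonneg_left (le_max_left (inner ℝ p (x' - x)) (inner ℝ q (x' - x))) hs
    have h4 := mul_le_mul_of_nonneg_left (le_max_right (inner ℝ p (x' - x)) (inner ℝ q (x' - x))) ht
    calc _ ≤ _ := add_le_add h3 h4
      _ = _ := by rw [← add_mul, hst, one_mul]
  rcases le_max_iff.1 hle with h | h
  · refine le_trans ?_ hpx
    gcongr
  · refine le_trans ?_ hqx
    gcongr

lemma subdiff_congr {ψ' : Eu d → EReal} {x : Eu d} (h : ψ =ᶠ[𝓝 x] ψ') :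
    subdiff Ω ψ x = subdiff Ω ψ' x := by
  have hx := h.self_of_nhds
  simp only [subdiff, hx]
  ext p
  refine and_congr Iff.rfl (and_congr Iff.rfl (forall₂_congr fun ε _ => ?_))
  exact eventually_congr ((h.filter_mono nhdsWithin_le_nhds).mono fun y hy => by rw [hy])

/-- The local-to-global step: a subgradient comes from some contact point, and the twist identifies
that point. -/
lemma SubdiffCondition.mem_cSubdiff_of_negGrad_mem (hs : SubdiffCondition c Ω Ω')
    (ht : Twist c Ω Ω') (hψ : CConvexFun c Ω Ω' ψ) {x y : Eu d} (hx : x ∈ Ω) (hy : y ∈ Ω')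
    (h : negGrad c x y ∈ subdiff Ω ψ x) : y ∈ cSubdiff c Ω Ω' ψ x := by
  rw [← (hs ψ hψ).2 x hx] at h
  obtain ⟨y', hy', heq⟩ := h
  exact ht x hx hy'.1 hy (neg_injective heq) ▸ hy'

end Subdiff

/-! ### Continuity of the gradient maps and of their inverses -/

section Gradient

lemma hasFDerivAt_left (hΩ : IsOpen Ω) (hΩ' : IsOpen Ω')
    (hc : ContDiffOn ℝ 1 (fun p : Eu d × Eu d => c p.1 p.2) (Ω ×ˢ Ω')) {x y : Eu d}
    (hx : x ∈ Ω) (hy : y ∈ Ω') :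
    HasFDerivAt (fun x' => c x' y) ((fderiv ℝ (fun p : Eu d × Eu d => c p.1 p.2) (x, y)).comp
      (ContinuousLinearMap.inl ℝ (Eu d) (Eu d))) x := by
  have h1 : HasFDerivAt (fun p : Eu d × Eu d => c p.1 p.2) _ (x, y) :=
    ((hc.differentiableOn one_ne_zero _ ⟨hx, hy⟩).differentiableAt
      ((hΩ.prod hΩ').mem_nhds ⟨hx, hy⟩)).hasFDerivAt
  exact h1.comp (f := fun x' => (x', y)) x (hasFDerivAt_prodMk_left x y)

lemma continuousOn_negGrad (hΩ : IsOpen Ω) (hΩ' : IsOpen Ω')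
    (hc : ContDiffOn ℝ 1 (fun p : Eu d × Eu d => c p.1 p.2) (Ω ×ˢ Ω')) :
    ContinuousOn (fun p : Eu d × Eu d => negGrad c p.1 p.2) (Ω ×ˢ Ω') := by
  have h1 := hc.continuousOn_fderiv_of_isOpen (hΩ.prod hΩ') le_rfl
  have h2 : ContinuousOn (fun p => (fderiv ℝ (fun p : Eu d × Eu d => c p.1 p.2) p).comp
      (ContinuousLinearMap.inl ℝ (Eu d) (Eu d))) (Ω ×ˢ Ω') := h1.clm_comp continuousOn_const
  have h3 : Continuous fun L : StrongDual ℝ (Eu d) => -(InnerProductSpace.toDual ℝ (Eu d)).symm L :=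
    (LinearIsometryEquiv.continuous _).neg
  refine (h3.comp_continuousOn h2).congr fun p hp => ?_
  simp only [negGrad, gradient]
  rw [(hasFDerivAt_left hΩ hΩ' hc hp.1 hp.2).fderiv]
  rfl

lemma contDiffOn_swapCost
    (hc : ContDiffOn ℝ 1 (fun p : Eu d × Eu d => c p.1 p.2) (Ω ×ˢ Ω')) :
    ContDiffOn ℝ 1 (fun p : Eu d × Eu d => swapCost c p.1 p.2) (Ω' ×ˢ Ω) :=
  hc.comp (g := fun p : Eu d × Eu d => c p.1 p.2) (f := Prod.swap)
    (contDiff_snd.prodMk contDiff_fst).contDiffOn fun _ hp => ⟨hp.2, hp.1⟩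

lemma Twist.tendsto_of_tendsto_negGrad (ht : Twist c Ω Ω') (hΩ : IsOpen Ω) (hΩ' : IsOpen Ω')
    (hc : ContDiffOn ℝ 1 (fun p : Eu d × Eu d => c p.1 p.2) (Ω ×ˢ Ω')) {x y : Eu d}
    (hx : x ∈ Ω) (hy : y ∈ Ω') {ι : Type*} {l : Filter ι} {u : ι → Eu d}
    (hu : ∀ᶠ i in l, u i ∈ Ω') (h : Tendsto (fun i => negGrad c x (u i)) l (𝓝 (negGrad c x y))) :
    Tendsto u l (𝓝 y) := by
  refine tendsto_of_tendsto_image_of_injOn (f := fun y => negGrad c x y) hΩ' ?_ ?_ hy hu h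
  · exact (continuousOn_negGrad hΩ hΩ' hc).uncurry_left x hx
  · exact fun y₁ h₁ y₂ h₂ heq => ht x hx h₁ h₂ (neg_injective heq)

/-- The set of all `(x, y)` with `(x, -∇ₓ c(x, y))` in a compact set `S` is compact,
provided `S` consists of such pairs. -/
lemma Twist.isCompact_preimage (ht : Twist c Ω Ω') (hΩ : IsOpen Ω) (hΩ' : IsOpen Ω')
    (hc : ContDiffOn ℝ 1 (fun p : Eu d × Eu d => c p.1 p.2) (Ω ×ˢ Ω')) {S : Set (Eu d × Eu d)}
    (hS : IsCompact S) (hSU : S ⊆ (fun p => (p.1, negGrad c p.1 p.2)) '' (Ω ×ˢ Ω')) :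
    ∃ K, IsCompact K ∧ ∀ x ∈ Ω, ∀ y ∈ Ω', (x, negGrad c x y) ∈ S → (x, y) ∈ K := by
  let F : Eu d × Eu d → Eu d × Eu d := fun p => (p.1, negGrad c p.1 p.2)
  have hF : ContinuousOn F (Ω ×ˢ Ω') := continuousOn_fst.prodMk (continuousOn_negGrad hΩ hΩ' hc)
  have hinj : InjOn F (Ω ×ˢ Ω') := by
    rintro ⟨x, y⟩ ⟨hx, hy⟩ ⟨x', y'⟩ ⟨hx', hy'⟩ heq
    obtain ⟨h1, h2⟩ := Prod.mk.inj heq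
    simp only at h1 h2 hx hy hy'
    subst h1
    rw [ht x hx hy hy' (neg_injective h2)]
  let G := Function.invFunOn F (Ω ×ˢ Ω')
  have hG : ∀ s ∈ S, G s ∈ Ω ×ˢ Ω' ∧ F (G s) = s := fun s hs =>
    ⟨Function.invFunOn_mem (hSU hs), Function.invFunOn_eq (hSU hs)⟩
  have hGc : ContinuousOn G S := by
    intro s hs
    refine tendsto_of_tendsto_image_of_injOn (hΩ.prod hΩ') hF hinj (hG s hs).1
      (eventually_mem_nhdsWithin.mono fun s' hs' => (hG s' hs').1) ?_
    rw [(hG s hs).2]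
    exact (tendsto_id.mono_left nhdsWithin_le_nhds).congr'
      (eventually_mem_nhdsWithin.mono fun s' hs' => (hG s' hs').2.symm)
  refine ⟨G '' S, hS.image_of_continuousOn hGc, fun x hx y hy hxy => ⟨_, hxy, ?_⟩⟩
  exact hinj (hG _ hxy).1 ⟨hx, hy⟩ (hG _ hxy).2

end Gradient

end CostTransport

namespace CostTransport

variable {d : ℕ} {c : Eu d → Eu d → ℝ} {Ω Ω' : Set (Eu d)} {ψ : Eu d → EReal}

/-! ### Compact subdifferential graphs of semiconvex functions -/

section Semiconvex

open Metric

lemma ConvexExt.convexOn_of_eq {U W : Set (Eu d)} {g : Eu d → EReal} {k : Eu d → ℝ}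
    (hg : ConvexExt U g) (hWU : W ⊆ U) (hW : Convex ℝ W) (hk : ∀ x ∈ W, g x = k x) :
    ConvexOn ℝ W k := by
  refine ⟨hW, fun x hx y hy s t hs ht hst => ?_⟩
  have h1 : (x, k x) ∈ {p : Eu d × ℝ | p.1 ∈ U ∧ g p.1 ≤ (p.2 : EReal)} :=
    ⟨hWU hx, (hk x hx).le⟩
  have h2 : (y, k y) ∈ {p : Eu d × ℝ | p.1 ∈ U ∧ g p.1 ≤ (p.2 : EReal)} :=
    ⟨hWU hy, (hk y hy).le⟩
  have h3 := (hg h1 h2 hs ht hst).2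
  simp only [Prod.fst_add, Prod.smul_fst, Prod.snd_add, Prod.smul_snd] at h3
  rw [hk _ (hW hx hy hs ht hst)] at h3
  exact_mod_cast h3

lemma eventually_le_of_hasGradientAt {h : Eu d → ℝ} {x v : Eu d} (hh : HasGradientAt h v x)
    {ε : ℝ} (hε : 0 < ε) :
    ∀ᶠ w in 𝓝 x, |h w - h x - inner ℝ v (w - x)| ≤ ε * ‖w - x‖ := by
  have := (hasGradientAt_iff_isLittleO.1 hh).bound hε
  simpa only [Real.norm_eq_abs] using this

/-- Near a point of `W`, the subdifferential of `k + h` with `k` convex and `h` differentiable is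
the convex subdifferential of `k`, translated by the gradient of `h`. -/
lemma mem_subdiff_iff_of_eq_add {W : Set (Eu d)} (hΩ : IsOpen Ω) (hWΩ : W ⊆ Ω) (hW : IsOpen W)
    {k h : Eu d → ℝ} (hk : ConvexOn ℝ W k) (hψ : ∀ x ∈ W, ψ x = ((k x + h x : ℝ) : EReal))
    {x v p : Eu d} (hx : x ∈ W) (hh : HasGradientAt h v x) :
    p ∈ subdiff Ω ψ x ↔ ∀ z ∈ W, k x + inner ℝ (p - v) (z - x) ≤ k z := by
  have hnhds : W ∈ 𝓝 x := hW.mem_nhds hx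
  constructor
  · rintro ⟨-, -, hp⟩ z hz
    rw [(hΩ.nhdsWithin_eq (hWΩ hx))] at hp
    refine le_of_forall_pos_le_add fun ε hε => ?_
    let η : ℝ := ε / (2 * (‖z - x‖ + 1))
    have hη : 0 < η := by positivity
    have hloc : ∀ᶠ w in 𝓝 x, k x + inner ℝ (p - v) (w - x) - 2 * η * ‖w - x‖ ≤ k w := by
      filter_upwards [hp η hη, eventually_le_of_hasGradientAt hh hη, hnhds] with w h1 h2 hw
      rw [hψ x hx, hψ w hw] at h1
      have h1' : k x + h x + (inner ℝ p (w - x) - η * ‖w - x‖) ≤ k w + h w := by exact_mod_cast h1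
      rw [inner_sub_left]
      linarith [(abs_le.1 h2).2]
    -- The local inequality is used at a point of the segment close to `x`; convexity of `k` carries
    -- it to `z`.
    have hline : Tendsto (fun t : ℝ => x + t • (z - x)) (𝓝[>] 0) (𝓝 x) := by
      have : Continuous fun t : ℝ => x + t • (z - x) := by fun_prop
      simpa using (this.tendsto 0).mono_left nhdsWithin_le_nhds
    obtain ⟨t, ht, ht0, ht1⟩ := ((hline.eventually hloc).and
      (Ioo_mem_nhdsGT (zero_lt_one (α := ℝ)))).exists
    rw [add_sub_cancel_left, real_inner_smul_right, norm_smul, Real.norm_of_nonneg ht0.le] at ht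
    have hcv := hk.2 hx hz (sub_nonneg.2 ht1.le) ht0.le (by ring)
    rw [show (1 - t) • x + t • z = x + t • (z - x) by module, smul_eq_mul, smul_eq_mul] at hcv
    have h3 : t * (k x + inner ℝ (p - v) (z - x) - 2 * η * ‖z - x‖) ≤ t * k z := by linarith
    have h4 := le_of_mul_le_mul_left h3 ht0
    have h5 : 2 * η * ‖z - x‖ ≤ ε := by
      have : 2 * η * (‖z - x‖ + 1) = ε := by
        have : ‖z - x‖ + 1 ≠ 0 := by positivity
        simp only [η]; field_simp
      nlinarith
    linarith
  · intro hp
    refine ⟨by rw [hψ x hx]; exact EReal.coe_ne_top _, by rw [hψ x hx]; exact EReal.coe_ne_bot _,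
      fun ε hε => ?_⟩
    rw [(hΩ.nhdsWithin_eq (hWΩ hx))]
    filter_upwards [eventually_le_of_hasGradientAt hh hε, hnhds] with w h2 hw
    have h1 := hp w hw
    rw [inner_sub_left] at h1
    rw [hψ x hx, hψ w hw]
    have : k x + h x + (inner ℝ p (w - x) - ε * ‖w - x‖) ≤ k w + h w := by
      linarith [(abs_le.1 h2).1]
    exact_mod_cast this

/-- The graph of the convex subdifferential over a compact ball, translated by a continuous
vector field, is compact. -/
lemma ConvexOn.isCompact_graph {x : Eu d} {ρ : ℝ} (hρ : 0 < ρ) {k : Eu d → ℝ} {v : Eu d → Eu d}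
    (hk : ConvexOn ℝ (ball x (2 * ρ)) k) (hv : ContinuousOn v (closedBall x ρ)) :
    IsCompact {q : Eu d × Eu d | q.1 ∈ closedBall x ρ ∧
      ∀ z ∈ ball x (2 * ρ), k q.1 + inner ℝ (q.2 - v q.1) (z - q.1) ≤ k z} := by
  have hkc : ContinuousOn k (ball x (2 * ρ)) := hk.continuousOn isOpen_ball
  have hsub : closedBall x ρ ⊆ ball x (2 * ρ) := closedBall_subset_ball (by linarith)
  have hsub' : closedBall x (3 / 2 * ρ) ⊆ ball x (2 * ρ) := closedBall_subset_ball (by linarith)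
  obtain ⟨M, hM⟩ := (isCompact_closedBall x (3 / 2 * ρ)).exists_bound_of_continuousOn
    (hkc.mono hsub')
  obtain ⟨V, hV⟩ := (isCompact_closedBall x ρ).exists_bound_of_continuousOn hv
  refine ((isCompact_closedBall x ρ).prod
    (isCompact_closedBall (0 : Eu d) (4 * M / ρ + V))).of_isClosed_subset ?_ ?_
  · have hcl : IsClosed (closedBall x ρ ×ˢ (univ : Set (Eu d))) := isClosed_closedBall.prod isClosed_univ
    have heq : {q : Eu d × Eu d | q.1 ∈ closedBall x ρ ∧
        ∀ z ∈ ball x (2 * ρ), k q.1 + inner ℝ (q.2 - v q.1) (z - q.1) ≤ k z} =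
        (closedBall x ρ ×ˢ (univ : Set (Eu d))) ∩ ⋂ z ∈ ball x (2 * ρ),
          (closedBall x ρ ×ˢ (univ : Set (Eu d))) ∩
          (fun q : Eu d × Eu d => k q.1 + inner ℝ (q.2 - v q.1) (z - q.1)) ⁻¹' Iic (k z) := by
      ext q
      simp only [mem_ofPred_eq, mem_inter_iff, mem_prod, mem_univ, and_true, mem_iInter,
        mem_preimage, mem_Iic]
      exact ⟨fun h => ⟨h.1, fun z hz => ⟨h.1, h.2 z hz⟩⟩, fun h => ⟨h.1, fun z hz => (h.2 z hz).2⟩⟩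
    rw [heq]
    refine hcl.inter (isClosed_biInter fun z _ => ?_)
    refine ContinuousOn.preimage_isClosed_of_isClosed ?_ hcl isClosed_Iic
    have h1 : ContinuousOn (fun q : Eu d × Eu d => k q.1) (closedBall x ρ ×ˢ univ) :=
      (hkc.mono hsub).comp continuousOn_fst fun q hq => hq.1
    have h2 : ContinuousOn (fun q : Eu d × Eu d => v q.1) (closedBall x ρ ×ˢ univ) :=
      hv.comp continuousOn_fst fun q hq => hq.1
    exact h1.add ((continuousOn_snd.sub h2).inner (𝕜 := ℝ) (by fun_prop))
  · rintro ⟨a, p⟩ ⟨ha, hp⟩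
    refine ⟨ha, ?_⟩
    simp only at ha hp
    rw [mem_closedBall_zero_iff]
    have hM0 : 0 ≤ M := (norm_nonneg _).trans
      (hM a (closedBall_subset_closedBall (by linarith) ha))
    have hq : ‖p - v a‖ ≤ 4 * M / ρ := by
      rcases eq_or_ne (p - v a) 0 with h0 | h0
      · rw [h0, norm_zero]; positivity
      set q := p - v a with hqdef
      have hqn : 0 < ‖q‖ := norm_pos_iff.2 h0
      -- Testing the subgradient a distance `ρ / 2` along `q` gives `ρ / 2 * ‖q‖ ≤ 2 * M`.
      have hz : a + (ρ / 2 * ‖q‖⁻¹) • q ∈ closedBall x (3 / 2 * ρ) := by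
        rw [mem_closedBall, dist_eq_norm] at ha ⊢
        have h1 : ‖(ρ / 2 * ‖q‖⁻¹) • q‖ = ρ / 2 := by
          rw [norm_smul, Real.norm_of_nonneg (by positivity), mul_assoc, inv_mul_cancel₀ hqn.ne',
            mul_one]
        calc ‖a + (ρ / 2 * ‖q‖⁻¹) • q - x‖ = ‖(a - x) + (ρ / 2 * ‖q‖⁻¹) • q‖ := by congr 1; abel
          _ ≤ ‖a - x‖ + ‖(ρ / 2 * ‖q‖⁻¹) • q‖ := norm_add_le _ _
          _ ≤ 3 / 2 * ρ := by rw [h1]; linarith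
      have h2 := hp _ (hsub' hz)
      rw [add_sub_cancel_left, real_inner_smul_right, real_inner_self_eq_norm_sq] at h2
      have h3 := abs_le.1 (hM _ hz)
      have h4 := abs_le.1 (hM a (closedBall_subset_closedBall (by linarith) ha))
      have h5 : ρ / 2 * ‖q‖⁻¹ * ‖q‖ ^ 2 = ρ / 2 * ‖q‖ := by field_simp
      rw [h5] at h2
      rw [le_div_iff₀ hρ]
      linarith [h3.2, h4.1]
    calc ‖p‖ = ‖(p - v a) + v a‖ := by rw [sub_add_cancel]
      _ ≤ ‖p - v a‖ + ‖v a‖ := norm_add_le _ _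
      _ ≤ _ := add_le_add hq (hV a ha)

/-- The graph of the subdifferential of a locally semiconvex function is compact over small balls
around an interior point of its domain. -/
lemma LocallySemiconvexOn.exists_isCompact_graph (hψ : LocallySemiconvexOn Ω ψ) (hΩ : IsOpen Ω)
    {x : Eu d} (hx : x ∈ Ω) (hfin : ∀ᶠ x' in 𝓝 x, ψ x' ≠ ⊤ ∧ ψ x' ≠ ⊥) :
    ∃ ρ₀ > 0, ∀ ρ, 0 < ρ → ρ ≤ ρ₀ → closedBall x ρ ⊆ Ω ∧
      IsCompact {q : Eu d × Eu d | q.1 ∈ closedBall x ρ ∧ q.2 ∈ subdiff Ω ψ q.1} := by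
  obtain ⟨r, hr, hrΩ, g, h, hg, hh, ⟨K, hK⟩, heq⟩ := hψ x hx
  obtain ⟨r', hr', hfin'⟩ := Metric.eventually_nhds_iff_ball.1 hfin
  refine ⟨min r r' / 2, by positivity, fun ρ hρ hρle => ?_⟩
  have hρr : 2 * ρ ≤ r := by linarith [min_le_left r r']
  have hρr' : 2 * ρ ≤ r' := by linarith [min_le_right r r']
  have hWr : ball x (2 * ρ) ⊆ ball x r := ball_subset_ball hρr
  have hsub : closedBall x ρ ⊆ ball x (2 * ρ) := closedBall_subset_ball (by linarith)
  let k : Eu d → ℝ := fun z => (ψ z).toReal - h z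
  have hψk : ∀ z ∈ ball x (2 * ρ), ψ z = ((k z + h z : ℝ) : EReal) := fun z hz => by
    have := hfin' z (ball_subset_ball hρr' hz)
    simp only [k, sub_add_cancel, EReal.coe_toReal this.1 this.2]
  have hgk : ∀ z ∈ ball x (2 * ρ), g z = k z := fun z hz => by
    have h1 := heq z (hWr hz)
    rw [hψk z hz, EReal.coe_add] at h1
    have := congrArg (· - (h z : EReal)) h1
    simpa only [EReal.add_sub_cancel_right] using this.symm
  have hk : ConvexOn ℝ (ball x (2 * ρ)) k := hg.convexOn_of_eq hWr (convex_ball _ _) hgk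
  have hWΩ := hWr.trans hrΩ
  refine ⟨hsub.trans hWΩ, ?_⟩
  have := ConvexOn.isCompact_graph hρ hk (v := gradient h)
    (hK.continuousOn.mono (hsub.trans hWr))
  convert this using 1
  ext ⟨a, p⟩
  refine and_congr_right fun ha => ?_
  have hd : DifferentiableAt ℝ h a :=
    (hh a (hWr (hsub ha))).differentiableAt (isOpen_ball.mem_nhds (hWr (hsub ha)))
  exact mem_subdiff_iff_of_eq_add hΩ hWΩ isOpen_ball hk hψk (hsub ha) hd.hasGradientAt

end Semiconvex

end CostTransport

/-! ### Contact pairs outside `Γ` -/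

namespace CostTransport

variable {d : ℕ} {c : Eu d → Eu d → ℝ} {Ω Ω' X₀ Y₀ : Set (Eu d)} {Γ : Set (Eu d × Eu d)}
  {ψ : Eu d → EReal}

open Metric

/-- Every point of `X₀` or `Y₀` has a partner in `Γ`, so `ψ` and `ψᶜ` are finite there and the rate
is a real, nonnegative gap. -/
lemma rateFun_eq_zero_or_pos (hX₀ : X₀ = Prod.fst '' Γ) (hY₀ : Y₀ = Prod.snd '' Γ)
    (hX : X₀ ⊆ Ω) (hY : Y₀ ⊆ Ω') (hψ : IsKantorovichPotential c Ω Ω' Γ ψ)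
    (hI : ∀ x ∈ X₀, ∀ y ∈ Y₀, rateFun c Γ x y = (c x y : EReal) - cTransform c Ω ψ y + ψ x)
    {x y : Eu d} (hx : x ∈ X₀) (hy : y ∈ Y₀) :
    (y ∈ cSubdiff c Ω Ω' ψ x ∧ rateFun c Γ x y = 0) ∨
      (y ∉ cSubdiff c Ω Ω' ψ x ∧ 0 < rateFun c Γ x y) := by
  have hfx : ∃ a : ℝ, ψ x = a := by
    subst hX₀
    obtain ⟨⟨x, y'⟩, hp, rfl⟩ := hx
    obtain ⟨a, ha, -⟩ := cTransform_eq_of_mem_cSubdiff (hX ⟨_, hp, rfl⟩) (hψ.2 _ hp)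
    exact ⟨a, ha⟩
  have hfy : ∃ b : ℝ, cTransform c Ω ψ y = b := by
    subst hY₀ hX₀
    obtain ⟨⟨x', y⟩, hp, rfl⟩ := hy
    obtain ⟨a, -, ha⟩ := cTransform_eq_of_mem_cSubdiff (hX ⟨_, hp, rfl⟩) (hψ.2 _ hp)
    exact ⟨_, ha⟩
  obtain ⟨a, ha⟩ := hfx
  obtain ⟨b, hb⟩ := hfy
  have hle := cTransform_le (c := c) (ψ := ψ) (hX hx) y
  rw [ha, hb, ← EReal.coe_add, EReal.coe_le_coe_iff] at hle
  rw [hI x hx y hy, ha, hb, ← EReal.coe_sub, ← EReal.coe_add]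
  rcases hle.eq_or_lt with h | h
  · left
    refine ⟨mem_cSubdiff_of_cTransform_eq (hY hy) ha (by rw [hb, h]), ?_⟩
    rw [EReal.coe_eq_zero]; linarith
  · right
    refine ⟨fun hmem => ?_, ?_⟩
    · obtain ⟨a', ha', hT⟩ := cTransform_eq_of_mem_cSubdiff (hX hx) hmem
      rw [ha, EReal.coe_eq_coe_iff] at ha'
      rw [hb, EReal.coe_eq_coe_iff, ← ha'] at hT
      linarith
    · rw [EReal.coe_pos]; linarith

/-- If `y` lies in the `c`-subdifferential at two distinct points of `X₀`, then it does so at points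
of `interior X₀` arbitrarily close to the first of them: follow the `c`-segment. -/
lemma CostAssumption.exists_mem_interior_mem_cSubdiff (hc : CostAssumption c Ω Ω' X₀ Y₀)
    (hψ : CConvexFun c Ω Ω' ψ) {x x' y : Eu d} (hx : x ∈ X₀) (hx' : x' ∈ X₀) (hne : x ≠ x')
    (hy : y ∈ Y₀) (h : y ∈ cSubdiff c Ω Ω' ψ x) (h' : y ∈ cSubdiff c Ω Ω' ψ x')
    {r : ℝ} (hr : 0 < r) :
    ∃ z ∈ interior X₀ ∩ ball x r, y ∈ cSubdiff c Ω Ω' ψ z := by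
  have hyΩ := hc.subset_right hy
  have hXΩ := hc.subset_left
  let φ : Eu d → EReal := fun y => -cTransform c Ω ψ y
  have hφ : CConvexFun (swapCost c) Ω' Ω φ := by
    refine hψ.neg_cTransform hyΩ ?_
    obtain ⟨a, -, ha⟩ := cTransform_eq_of_mem_cSubdiff (hXΩ hx) h
    rw [ha]; exact EReal.coe_ne_bot _
  have hsub : ∀ w ∈ X₀, y ∈ cSubdiff c Ω Ω' ψ w →
      negGrad (swapCost c) y w ∈ subdiff Ω' φ y := fun w hw hmem => by
    rw [← (hc.subdiff_right φ hφ).2 y hyΩ]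
    exact ⟨w, (hψ.mem_cSubdiff_neg_cTransform_iff (hXΩ hw) hyΩ).2 hmem, rfl⟩
  let p : ℝ → Eu d := fun t =>
    (1 - t) • negGrad (swapCost c) y x + t • negGrad (swapCost c) y x'
  have hp : ∀ t ∈ Ioo (0 : ℝ) 1, ∃ z ∈ X₀, negGrad (swapCost c) y z = p t := by
    intro t ht
    exact hc.strict.1 y hy x hx x' hx'
      ⟨1 - t, t, sub_nonneg.2 ht.2.le, ht.1.le, by ring, rfl⟩
  choose! z hzX hz using hp
  have hzint : ∀ t ∈ Ioo (0 : ℝ) 1, z t ∈ interior X₀ := fun t ht =>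
    hc.strict.2 y hy x hx x' hx' hne _ (hzX t ht)
      (by rw [hz t ht]; exact ⟨1 - t, t, sub_pos.2 ht.2, ht.1, by ring, rfl⟩)
  have hzsub : ∀ t ∈ Ioo (0 : ℝ) 1, y ∈ cSubdiff c Ω Ω' ψ (z t) := fun t ht => by
    rw [← hψ.mem_cSubdiff_neg_cTransform_iff (hXΩ (hzX t ht)) hyΩ]
    refine hc.subdiff_right.mem_cSubdiff_of_negGrad_mem hc.twist_right hφ hyΩ (hXΩ (hzX t ht)) ?_
    rw [hz t ht]
    exact subdiff_convex Ω' φ y (hsub x hx h) (hsub x' hx' h') (sub_nonneg.2 ht.2.le) ht.1.le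
      (by ring)
  have hIoo : ∀ᶠ t : ℝ in 𝓝[>] 0, t ∈ Ioo (0 : ℝ) 1 := Ioo_mem_nhdsGT zero_lt_one
  have hlim : Tendsto z (𝓝[>] 0) (𝓝 x) := by
    refine hc.twist_right.tendsto_of_tendsto_negGrad hc.isOpen_right hc.isOpen_left
      (contDiffOn_swapCost hc.contDiffOn) hyΩ (hXΩ hx)
      (hIoo.mono fun t ht => hXΩ (hzX t ht)) ?_
    have hpc : Continuous p := by fun_prop
    have hp0 : Tendsto p (𝓝[>] 0) (𝓝 (negGrad (swapCost c) y x)) := by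
      simpa [p] using (hpc.tendsto 0).mono_left nhdsWithin_le_nhds
    exact hp0.congr' (hIoo.mono fun t ht => (hz t ht).symm)
  obtain ⟨t, htb, ht⟩ := ((hlim.eventually (ball_mem_nhds x hr)).and hIoo).exists
  exact ⟨z t, ⟨hzint t ht, htb⟩, hzsub t ht⟩

lemma Twist.volume_setOf_sub_eq_zero (ht : Twist c Ω Ω') (hΩ : IsOpen Ω) (hΩ' : IsOpen Ω')
    (hc : ContDiffOn ℝ 1 (fun p : Eu d × Eu d => c p.1 p.2) (Ω ×ˢ Ω')) {y y' : Eu d}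
    (hy : y ∈ Ω') (hy' : y' ∈ Ω') (hne : y ≠ y') (a : ℝ) :
    volume {x | x ∈ Ω ∧ c x y - c x y' = a} = 0 := by
  have hd : ∀ x ∈ Ω, ∀ y ∈ Ω', DifferentiableAt ℝ (fun x' => c x' y) x := fun x hx y hy =>
    (hasFDerivAt_left hΩ hΩ' hc hx hy).differentiableAt
  refine Measure.addHaar_eq_zero_of_hasFDerivAt_ne_zero volume (f := fun x => c x y - c x y')
    (f' := fun x => fderiv ℝ (fun x' => c x' y) x - fderiv ℝ (fun x' => c x' y') x) (a := a)
    (fun x hx => (hd x hx.1 y hy).hasFDerivAt.sub (hd x hx.1 y' hy').hasFDerivAt)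
    (fun x hx h => hne (ht x hx.1 hy hy' ?_)) fun x hx => hx.2
  simp only [gradient]
  rw [sub_eq_zero.1 h]

/-- The finitely many `y' ≠ y` that are coupled with points near `x`. -/
lemma CostAssumption.exists_finite_image (hc : CostAssumption c Ω Ω' X₀ Y₀) (hX₀ : X₀ = Prod.fst '' Γ)
    (hψ : IsKantorovichPotential c Ω Ω' Γ ψ) {N : Set (Eu d)} (hN : ∀ y, ¬ AccPt y (𝓟 N))
    (hΓN : ∀ p ∈ Γ, p.2 ∈ N) {x : Eu d} (hx : x ∈ interior X₀) :
    ∃ ρ₀ > 0, ∀ ρ, 0 < ρ → ρ ≤ ρ₀ →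
      closedBall x ρ ⊆ X₀ ∧ {y' | ∃ x' ∈ closedBall x ρ, (x', y') ∈ Γ}.Finite := by
  have hΩ := hc.isOpen_left
  have hfin : ∀ x' ∈ X₀, ψ x' ≠ ⊤ ∧ ψ x' ≠ ⊥ := by
    rw [hX₀]
    rintro _ ⟨p, hp, rfl⟩
    obtain ⟨a, ha, -⟩ := cTransform_eq_of_mem_cSubdiff
      (hc.subset_left (hX₀ ▸ ⟨p, hp, rfl⟩)) (hψ.2 p hp)
    rw [ha]
    exact ⟨EReal.coe_ne_top _, EReal.coe_ne_bot _⟩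
  obtain ⟨hsemi, hsub⟩ := hc.subdiff_left ψ hψ.1
  obtain ⟨ρ₁, hρ₁, hcomp⟩ := hsemi.exists_isCompact_graph hΩ (hc.subset_left (interior_subset hx))
    (mem_of_superset (mem_interior_iff_mem_nhds.1 hx) hfin)
  obtain ⟨ρ₂, hρ₂, hball⟩ := nhds_basis_closedBall.mem_iff.1 (mem_interior_iff_mem_nhds.1 hx)
  refine ⟨min ρ₁ ρ₂, lt_min hρ₁ hρ₂, fun ρ hρ hle => ?_⟩
  have hbX : closedBall x ρ ⊆ X₀ :=
    (closedBall_subset_closedBall (hle.trans (min_le_right _ _))).trans hball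
  refine ⟨hbX, ?_⟩
  obtain ⟨hbΩ, hS⟩ := hcomp ρ hρ (hle.trans (min_le_left _ _))
  -- The compact graph of `∂ψ` pulls back to a compact set of contact pairs; infinitely many
  -- partners would accumulate there.
  obtain ⟨K, hK, hKS⟩ := hc.twist_left.isCompact_preimage hΩ hc.isOpen_right hc.contDiffOn hS (by
    rintro ⟨a, p⟩ ⟨ha, hp⟩
    simp only at ha hp
    rw [← hsub a (hbΩ ha)] at hp
    obtain ⟨b, hb, rfl⟩ := hp
    exact ⟨(a, b), ⟨hbΩ ha, hb.1⟩, rfl⟩)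
  by_contra hinf
  obtain ⟨y, -, hacc⟩ := Set.Infinite.exists_accPt_of_subset_isCompact hinf (hK.image continuous_snd)
    (by
      rintro y' ⟨x', hx', hp⟩
      have hmem := hψ.2 _ hp
      refine ⟨(x', y'), hKS x' (hbΩ hx') y' hmem.1 ⟨hx', ?_⟩, rfl⟩
      rw [← hsub x' (hbΩ hx')]
      exact ⟨y', hmem, rfl⟩)
  refine hN y (hacc.mono (principal_mono.2 ?_))
  rintro y' ⟨x', -, hp⟩
  exact hΓN _ hp

/-- If `y` lies in the `c`-subdifferential at an interior point `x` of `X₀` with `(x, y) ∉ Γ`, then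
the points coupled with `y` form a Lebesgue null set. -/
lemma CostAssumption.volume_setOf_mem_eq_zero (hc : CostAssumption c Ω Ω' X₀ Y₀)
    (hX₀ : X₀ = Prod.fst '' Γ) (hΓ : IsClosed Γ) (hψ : IsKantorovichPotential c Ω Ω' Γ ψ)
    {N : Set (Eu d)} (hN : ∀ y, ¬ AccPt y (𝓟 N)) (hΓN : ∀ p ∈ Γ, p.2 ∈ N) {x y : Eu d}
    (hx : x ∈ interior X₀) (hy : y ∈ cSubdiff c Ω Ω' ψ x) (hxy : (x, y) ∉ Γ) :
    volume {x' | (x', y) ∈ Γ} = 0 := by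
  have hΩ := hc.isOpen_left
  have hxΩ : x ∈ Ω := hc.subset_left (interior_subset hx)
  have hΓΩ : ∀ p ∈ Γ, p.1 ∈ Ω := fun p hp => hc.subset_left (hX₀ ▸ ⟨p, hp, rfl⟩)
  obtain ⟨ρ₁, hρ₁, hfin⟩ := hc.exists_finite_image hX₀ hψ hN hΓN hx
  have hnear : ∀ᶠ x' in 𝓝 x, (x', y) ∉ Γ := by
    have h1 : Continuous fun x' : Eu d => (x', y) := by fun_prop
    exact (hΓ.isOpen_compl.preimage h1).mem_nhds hxy
  obtain ⟨ρ₂, hρ₂, hnear'⟩ := nhds_basis_closedBall.eventually_iff.1 hnear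
  obtain ⟨hbX, hJfin⟩ := hfin (min ρ₁ ρ₂) (lt_min hρ₁ hρ₂) (min_le_left _ _)
  set B := closedBall x (min ρ₁ ρ₂) with hB
  have hBnhds : B ∈ 𝓝 x := closedBall_mem_nhds x (lt_min hρ₁ hρ₂)
  set J : Set (Eu d) := {y' | ∃ x' ∈ B, (x', y') ∈ Γ} with hJ
  have hyJ : y ∉ J := by
    rintro ⟨x', hx', hp⟩
    exact hnear' (closedBall_subset_closedBall (min_le_right _ _) hx') hp
  have hBJ : ∀ x' ∈ B, ∃ y' ∈ J, (x', y') ∈ Γ := fun x' hx' => by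
    have := hbX hx'
    rw [hX₀] at this
    obtain ⟨⟨_, y'⟩, hp, rfl⟩ := this
    exact ⟨y', ⟨_, hx', hp⟩, hp⟩
  have hJb : ∀ y' ∈ J, y' ∈ Ω' ∧ ∃ b : ℝ, cTransform c Ω ψ y' = b := by
    rintro y' ⟨x', -, hp⟩
    obtain ⟨a, -, ha⟩ := cTransform_eq_of_mem_cSubdiff (hΓΩ _ hp) (hψ.2 _ hp)
    exact ⟨(hψ.2 _ hp).1, _, ha⟩
  choose! hJΩ b hb using hJb
  classical
  -- The value `⊥` discards every point outside `J`, so `χ` is the maximum of the `c`-affine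
  -- functions of the partners near `x`. It lies below `ψ` on `Ω` and equals `ψ` on `B`.
  let ζ : Eu d → EReal := fun y' => if y' ∈ J then cTransform c Ω ψ y' else ⊥
  let χ : Eu d → EReal := fun x' => ⨆ y' ∈ Ω', (ζ y' - (c x' y' : EReal))
  have hχge : ∀ x' : Eu d, ∀ y' ∈ J, ((b y' - c x' y' : ℝ) : EReal) ≤ χ x' := fun x' y' hy' => by
    refine le_trans (le_of_eq ?_)
      (le_iSup₂ (f := fun y' _ => ζ y' - (c x' y' : EReal)) y' (hJΩ y' hy'))
    simp only [ζ, if_pos hy', hb y' hy', EReal.coe_sub]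
  have hχle : ∀ x' : Eu d, ∀ m : EReal, (∀ y' ∈ J, ((b y' - c x' y' : ℝ) : EReal) ≤ m) →
      χ x' ≤ m := fun x' m h => by
    refine iSup₂_le fun y' _ => ?_
    by_cases hy' : y' ∈ J
    · simp only [ζ, if_pos hy', hb y' hy', ← EReal.coe_sub]
      exact h y' hy'
    · simp only [ζ, if_neg hy', EReal.bot_sub, bot_le]
  have hχψ : ∀ x' ∈ Ω, χ x' ≤ ψ x' := fun x' hx' => hχle x' _ fun y' hy' => by
    have h1 := cTransform_le (c := c) (ψ := ψ) hx' y'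
    rw [hb y' hy', add_comm] at h1
    rwa [EReal.coe_sub, EReal.sub_le_iff_le_add (by simp) (by simp)]
  have hχeq : ∀ x' ∈ B, ψ x' = χ x' := fun x' hx' => by
    obtain ⟨y', hy', hp⟩ := hBJ x' hx'
    refine le_antisymm ?_ (hχψ x' (hΓΩ _ hp))
    obtain ⟨a, ha, hT⟩ := cTransform_eq_of_mem_cSubdiff (hΓΩ _ hp) (hψ.2 _ hp)
    rw [hb y' hy', EReal.coe_eq_coe_iff] at hT
    refine le_trans (le_of_eq ?_) (hχge x' y' hy')
    rw [ha, hT]; congr 1; ring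
  obtain ⟨y₁, hy₁, -⟩ := hBJ x (mem_of_mem_nhds hBnhds)
  have hχconv : CConvexFun c Ω Ω' χ := by
    refine ⟨fun x' _ => ?_, ⟨x, hxΩ, ?_⟩, ζ, fun _ _ => rfl⟩
    · exact ne_bot_of_le_ne_bot (EReal.coe_ne_bot _) (hχge x' y₁ hy₁)
    · obtain ⟨a, ha, -⟩ := cTransform_eq_of_mem_cSubdiff hxΩ hy
      exact ne_top_of_le_ne_top (by rw [ha]; exact EReal.coe_ne_top _) (hχψ x hxΩ)
  have hyχ : y ∈ cSubdiff c Ω Ω' χ x := by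
    refine hc.subdiff_left.mem_cSubdiff_of_negGrad_mem hc.twist_left hχconv hxΩ hy.1 ?_
    rw [← subdiff_congr (Ω := Ω) (mem_of_superset hBnhds hχeq : ψ =ᶠ[𝓝 x] χ),
      ← (hc.subdiff_left ψ hψ.1).2 x hxΩ]
    exact ⟨y, hy, rfl⟩
  obtain ⟨a, ha, hT⟩ := cTransform_eq_of_mem_cSubdiff hxΩ hy
  obtain ⟨-, a', ha', hsupp⟩ := (mem_cSubdiff_iff hxΩ).1 hyχ
  rw [← hχeq x (mem_of_mem_nhds hBnhds), ha, EReal.coe_eq_coe_iff] at ha'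
  subst ha'
  refine measure_mono_null (t := ⋃ y' ∈ J, {x' | x' ∈ Ω ∧ c x' y - c x' y' = c x y + a - b y'})
    ?_ ((measure_biUnion_null_iff hJfin.countable).2 fun y' hy' =>
      hc.twist_left.volume_setOf_sub_eq_zero hΩ hc.isOpen_right hc.contDiffOn hy.1 (hJΩ y' hy')
        (fun h => hyJ (h ▸ hy')) _)
  intro x' hp
  have hx'Ω : x' ∈ Ω := hΓΩ _ hp
  obtain ⟨a', ha', hT'⟩ := cTransform_eq_of_mem_cSubdiff hx'Ω (hψ.2 _ hp)
  simp only at ha' hT'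
  rw [hT, EReal.coe_eq_coe_iff] at hT'
  -- At `x'` the `c`-affine function of `y` equals `ψ` and lies below `χ ≤ ψ`, so it equals the one
  -- of a maximizing `y'`.
  obtain ⟨y', hy', hmax⟩ := Set.exists_max_image J (fun y' => b y' - c x' y') hJfin ⟨y₁, hy₁⟩
  have h1 : χ x' ≤ ((b y' - c x' y' : ℝ) : EReal) :=
    hχle x' _ fun y'' hy'' => EReal.coe_le_coe_iff.2 (hmax y'' hy'')
  have h2 := EReal.coe_le_coe_iff.1 ((hsupp x' hx'Ω).trans h1)
  have h3 := (hχge x' y' hy').trans (hχψ x' hx'Ω)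
  rw [ha', EReal.coe_le_coe_iff] at h3
  refine mem_biUnion hy' ⟨hx'Ω, ?_⟩
  linarith

/-- A point coupled by `π` with an isolated point of the support of its second marginal is coupled
with a set of positive measure. -/
lemma measure_setOf_mem_support_pos {π : Measure (Eu d × Eu d)} {x y : Eu d}
    (hxy : (x, y) ∈ π.support) (hy : ¬ AccPt y (𝓟 π.snd.support)) :
    0 < π.fst {x' | (x', y) ∈ π.support} := by
  have hclosed : IsClosed {x' | (x', y) ∈ π.support} :=
    π.isClosed_support.preimage (Continuous.prodMk_left y)
  rw [accPt_iff_frequently, not_frequently] at hy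
  obtain ⟨U, hU, hUo, hyU⟩ := _root_.eventually_nhds_iff.1 hy
  have hU0 : 0 < π (Prod.snd ⁻¹' U) :=
    (Measure.mem_support_iff_forall _).1 hxy _ ((hUo.preimage continuous_snd).mem_nhds hyU)
  rw [Measure.fst_apply hclosed.measurableSet]
  refine hU0.trans_le ?_
  have hsnd : π (Prod.snd ⁻¹' π.snd.supportᶜ) = 0 := by
    rw [← Measure.snd_apply Measure.isClosed_support.isOpen_compl.measurableSet]
    exact Measure.measure_compl_support
  -- `U` meets the support of the second marginal at most at `y`, so up to null sets the strip over
  -- `U` is coupled with `y` alone.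
  have hsub : Prod.snd ⁻¹' U ⊆ Prod.fst ⁻¹' {x' | (x', y) ∈ π.support} ∪
      (π.supportᶜ ∪ Prod.snd ⁻¹' π.snd.supportᶜ) := by
    rintro ⟨x', y'⟩ hy'
    by_cases h1 : (x', y') ∈ π.support
    · by_cases h2 : y' ∈ π.snd.support
      · left
        have : y' = y := by
          by_contra hne
          exact hU y' hy' ⟨hne, h2⟩
        exact this ▸ h1
      · exact Or.inr (Or.inr h2)
    · exact Or.inr (Or.inl h1)
  calc π (Prod.snd ⁻¹' U) ≤ _ := measure_mono hsub
    _ ≤ _ := measure_union_le _ _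
    _ = _ := by rw [measure_union_null Measure.measure_compl_support hsnd, add_zero]

lemma mem_snd_support_of_mem_support {π : Measure (Eu d × Eu d)} {p : Eu d × Eu d}
    (hp : p ∈ π.support) : p.2 ∈ π.snd.support := by
  rw [Measure.support_eq_forall_isOpen]
  intro U hpU hU
  rw [Measure.snd_apply hU.measurableSet]
  exact (Measure.mem_support_iff_forall _).1 hp _ ((hU.preimage continuous_snd).mem_nhds hpU)

end CostTransport

theorem proposition5p6 {d : ℕ} (c : CostTransport.Eu d → CostTransport.Eu d → ℝ)
    (Ω Ω' : Set (CostTransport.Eu d))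
    (μ ν : Measure (CostTransport.Eu d)) [IsProbabilityMeasure μ] [IsProbabilityMeasure ν]
    (π : Measure (CostTransport.Eu d × CostTransport.Eu d)) (hπμ : π.fst = μ) (hπν : π.snd = ν)
    (Γ : Set (CostTransport.Eu d × CostTransport.Eu d)) (hΓ : Γ = π.support)
    (X₀ Y₀ : Set (CostTransport.Eu d)) (hX₀ : X₀ = Prod.fst '' Γ) (hY₀ : Y₀ = Prod.snd '' Γ)
    (hc : CostTransport.CostAssumption c Ω Ω' X₀ Y₀)
    (hdual : ∃ ψ : CostTransport.Eu d → EReal,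
      CostTransport.IsKantorovichPotential c Ω Ω' Γ ψ ∧
      ∀ x ∈ X₀, ∀ y ∈ Y₀, CostTransport.rateFun c Γ x y =
        (c x y : EReal) - CostTransport.cTransform c Ω ψ y + ψ x) :
    (∀ x ∈ X₀, ∀ y ∈ Y₀, (x, y) ∉ Γ → x ∈ frontier X₀ →
      (∃ r : ℝ, 0 < r ∧ ∀ x' ∈ interior X₀ ∩ Metric.ball x r,
        0 < CostTransport.rateFun c Γ x' y) →
      0 < CostTransport.rateFun c Γ x y) ∧
    (μ ≪ volume → ν.support.Countable → (∀ y, ¬ AccPt y (𝓟 ν.support)) →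
      {p : CostTransport.Eu d × CostTransport.Eu d | CostTransport.rateFun c Γ p.1 p.2 = 0} ∩
        X₀ ×ˢ Y₀ = Γ) := by
  open CostTransport in
  obtain ⟨ψ, hψ, hI⟩ := hdual
  have hdich := fun {x y} => rateFun_eq_zero_or_pos (x := x) (y := y) hX₀ hY₀ hc.subset_left
    hc.subset_right hψ hI
  have hpos : ∀ {x y}, x ∈ X₀ → y ∈ Y₀ → y ∉ cSubdiff c Ω Ω' ψ x → 0 < rateFun c Γ x y :=
    fun hx hy h => (hdich hx hy).elim (fun h' => absurd h'.1 h) And.right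
  have hzero : ∀ {x y}, x ∈ X₀ → y ∈ Y₀ → y ∈ cSubdiff c Ω Ω' ψ x → rateFun c Γ x y = 0 :=
    fun hx hy h => (hdich hx hy).elim And.right (fun h' => absurd h h'.1)
  -- Stated on all of `X₀`, so that it also finishes the second claim.
  have hboundary : ∀ x ∈ X₀, ∀ y ∈ Y₀, (x, y) ∉ Γ →
      (∃ r : ℝ, 0 < r ∧ ∀ x' ∈ interior X₀ ∩ Metric.ball x r, 0 < rateFun c Γ x' y) →
      0 < rateFun c Γ x y := by
    rintro x hx y hy hxy ⟨r, hr, hint⟩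
    refine hpos hx hy fun hmem => ?_
    obtain ⟨⟨x', _⟩, hp, rfl⟩ : y ∈ Prod.snd '' Γ := hY₀ ▸ hy
    have hx' : x' ∈ X₀ := hX₀ ▸ ⟨_, hp, rfl⟩
    obtain ⟨z, hz, hzmem⟩ := hc.exists_mem_interior_mem_cSubdiff hψ.1 hx hx'
      (by rintro rfl; exact hxy hp) hy hmem (hψ.2 _ hp) hr
    have := hint z hz
    rw [hzero (interior_subset hz.1) hy hzmem] at this
    exact lt_irrefl _ this
  refine ⟨fun x hx y hy hxy _ h => hboundary x hx y hy hxy h, fun hμ _ hN => ?_⟩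
  have hΓc : IsClosed Γ := hΓ ▸ Measure.isClosed_support
  have hinterior : ∀ x ∈ interior X₀, ∀ y ∈ Y₀, (x, y) ∉ Γ → 0 < rateFun c Γ x y := by
    intro x hx y hy hxy
    refine hpos (interior_subset hx) hy fun hmem => ?_
    have hnull := hc.volume_setOf_mem_eq_zero hX₀ hΓc hψ hN
      (fun p hp => hπν ▸ mem_snd_support_of_mem_support (hΓ ▸ hp)) hx hmem hxy
    obtain ⟨⟨x', _⟩, hp, rfl⟩ : y ∈ Prod.snd '' Γ := hY₀ ▸ hy
    subst hΓ hπν hπμ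
    exact (measure_setOf_mem_support_pos hp (hN _)).ne' (hμ hnull)
  ext ⟨x, y⟩
  constructor
  · rintro ⟨h0, hx, hy⟩
    by_contra hxy
    refine lt_irrefl (0 : EReal) ?_
    have hpos' : 0 < rateFun c Γ x y := by
      refine hboundary x hx y hy hxy ?_
      -- Since `Γ` is closed, nearby interior points also form pairs outside `Γ`, where the rate is
      -- already known to be positive.
      have hnear : ∀ᶠ x' in 𝓝 x, (x', y) ∉ Γ :=
        (hΓc.isOpen_compl.preimage (Continuous.prodMk_left y)).mem_nhds hxy
      obtain ⟨r, hr, hball⟩ := Metric.eventually_nhds_iff_ball.1 hnear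
      exact ⟨r, hr, fun x' hx' => hinterior x' hx'.1 y hy (hball x' hx'.2)⟩
    exact hpos'.trans_eq h0
  · intro hp
    have hx : x ∈ X₀ := hX₀ ▸ ⟨_, hp, rfl⟩
    have hy : y ∈ Y₀ := hY₀ ▸ ⟨_, hp, rfl⟩
    exact ⟨hzero hx hy (hψ.2 _ hp), hx, hy⟩
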